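/- **Conventions.** $U(1)\subset\mathbb C$ is the circle group and $T^m=U(1)^m$. A ($d$-dimensional) *topological manifold* is a second-countable Hausdorff space that is locally homeomorphic to $\mathbb R^d$. For a compact Hausdorff space $L$, the open cone is $\mathring c(L)=L\times[0,1)/L\times\{0\}$, and $\mathring c(\emptyset)$ is a point. **Stratified pseudomanifolds.** Let $l,n\ge 0$. A *filtered space* is a Hausdorff space $Q\neq\emptyset$ with closed subsets $Q=Q_{l+n}\supsetneq Q_{l+n-1}\supseteq\cdots\supseteq Q_l\supsetneq Q_{l-1}=\emptyset$; its strata of dimension $k$ are the connected components of $Q_k\setminus Q_{k-1}$. It is an *$(l+n)$-dimensional topological stratified pseudomanifold* if either $l+n=0$ and $Q$ is discrete, or $l+n>0$ and: (1) every stratum of dimension $l+i$ is an $(l+i)$-dimensional topological manifold; (2) $Q_{l+n}\setminus Q_{l+n-1}$ is dense in $Q$; (3) each $p\in Q_{l+i}\setminus Q_{l+i-1}$ has an open neighbourhood $U_p$ and a homeomorphism $\varphi_p:U_p\to O_p\times\mathring c(L_p)$, where $O_p\subset\mathbb R^{l+i}$ is open and contractible, $L_p$ is empty or a compact $(n-i-1)$-dimensional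 topological stratified pseudomanifold, and $\varphi_p(U_p\cap Q_{l+i+j+1})=O_p\times\mathring c((L_p)_j)$ for $-1\le j\le n-i-1$. **Locally standard $T$-pseudomanifolds.** Let $l\ge0$, $m\ge n\ge 0$, and let $X$ be a second-countable compact Hausdorff space with a continuous effective action of $T^m$ all of whose isotropy subgroups $T_x$ are subtori (closed connected subgroups). Put $X_{l+2i+(m-n)}=X_{l+2i+1+(m-n)}=\{x\in X: \dim T^m x\le i+(m-n)\}$ for $0\le i\le n$, and $X_k=\emptyset$ for $k<l+m-n$. Assume that $X$ with this filtration is an $(l+m+n)$-dimensional topological stratified pseudomanifold, that no orbit has dimension less than $m-n$, and that $X$ has free orbits if $l+n\ne0$. By induction on $l+n$, $X$ is an *$(l+m+n)$-dimensional locally standard $T^m$-pseudomanifold* if * for $l+n=0$: $X$ is equivariantly homeomorphic to a finite disjoint union of copies of $T^m$ with the multiplicative action; * for $l+n>0$: every $x\in X$ with $\dim T^m x=i+(m-n)$ has a $T^m$-invariant open neighbourhood $U_x$ and a homeomorphism $\varphi_x:U_x\to O\times(\Omega\times U(1)^{m-n})\times\mathring c(L_x)$, where $O\subset\mathbb R^l$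 is open and contractible, $\Omega\subset(\mathbb C\setminus\{0\})^i$ is open and $U(1)^i$-invariant, and $L_x$ is empty or a $(2n-2i-1)$-dimensional locally standard $T_x$-pseudomanifold with $T_x\cong T^{n-i}$. Moreover $\varphi_x$ is equivariant along some isomorphism $T^m\cong T^m/T_x\times T_x\cong U(1)^{i+(m-n)}\times T^{n-i}$, where $U(1)^{i+(m-n)}$ acts on $\Omega\times U(1)^{m-n}$ by multiplication, $T_x$ acts on $\mathring c(L_x)$ by $t[v,s]=[tv,s]$, and the action on $O$ is trivial. The orbit space $Q=X/T^m$ is filtered by $Q_{l+i}=X_{l+2i+(m-n)}/T^m$. **Proposition.** Let $X$ be a locally standard $T$-pseudomanifold over a graph, that is, a connected locally standard $T^m$-pseudomanifold with $l=0$, $n=1$ (so $m\ge1$) and $\dim X=m+1\le 3$. Its orbit space $Q=X/T^m$ is regarded as a graph whose vertex set is $Q_0$, the set of orbits of dimension $m-1$. Then $X$ is a topological manifold (of some dimension) if and only if the graph $Q$ is an interval, i.e. consists of a single edge with two distinct vertices: there is a homeomorphism $Q\to[0,1]$ that maps $Q_0$ onto $\{0,1\}$. -/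

import Mathlib

universe u

/-- `M` is a `d`-dimensional topological manifold (without boundary): a second-countable Hausdorff
space which is locally homeomorphic to open subsets of `ℝ^d`. -/
structure IsTopManifold (d : ℕ) (M : Type u) [TopologicalSpace M] : Prop where
  t2 : T2Space M
  secondCountable : SecondCountableTopology M
  charted : Nonempty (ChartedSpace (EuclideanSpace ℝ (Fin d)) M)

/-! ### Open cones -/

/-- The points of `(L × [0,1)) ⊔ {*}` that are collapsed to the cone vertex: those of
`L × {0}`, together with `*`. -/
def ConeVertexPt {L : Type u} : (L × Set.Ico (0 : ℝ) 1) ⊕ Unit → Prop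
  | Sum.inl q => (q.2 : ℝ) = 0
  | Sum.inr _ => True

/-- The relation collapsing `L × {0} ⊔ {*}` to one point. -/
def coneSetoid (L : Type u) : Setoid ((L × Set.Ico (0 : ℝ) 1) ⊕ Unit) where
  r a b := a = b ∨ (ConeVertexPt a ∧ ConeVertexPt b)
  iseqv := by
    refine ⟨fun a => Or.inl rfl, ?_, ?_⟩
    · rintro a b (h | ⟨h, h'⟩)
      · exact Or.inl h.symm
      · exact Or.inr ⟨h', h⟩
    · rintro a b c (rfl | ⟨h, h'⟩) (rfl | ⟨k, k'⟩)
      · exact Or.inl rfl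
      · exact Or.inr ⟨k, k'⟩
      · exact Or.inr ⟨h, h'⟩
      · exact Or.inr ⟨h, k'⟩

/-- The open cone on `L`. The extra point `*` only matters for empty `L`: for nonempty `L` this
is the quotient space `L × [0,1) / L × {0}`, and the open cone on the empty space is a point. -/
def OpenCone (L : Type u) : Type u := Quotient (coneSetoid L)

instance (L : Type u) [TopologicalSpace L] : TopologicalSpace (OpenCone L) :=
  inferInstanceAs (TopologicalSpace (Quotient (coneSetoid L)))

namespace OpenCone

/-- The point `[v, s]` of the open cone. -/
def mk {L : Type u} (v : L) (s : Set.Ico (0 : ℝ) 1) : OpenCone L :=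
  Quotient.mk (coneSetoid L) (Sum.inl (v, s))

/-- The cone vertex. -/
def vertex (L : Type u) : OpenCone L := Quotient.mk (coneSetoid L) (Sum.inr ())

/-- The map `[v, s] ↦ [f v, s]` of open cones. -/
def map {L : Type u} (f : L → L) : OpenCone L → OpenCone L :=
  Quotient.map (Sum.map (Prod.map f id) id) (by
    rintro a b (rfl | ⟨ha, hb⟩)
    · exact Or.inl rfl
    · refine Or.inr ⟨?_, ?_⟩
      · cases a <;> exact ha
      · cases b <;> exact hb)

/-- The filtration of the open cone: its `0`-skeleton is the vertex (the cone on the empty set)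
and its `(j+1)`-skeleton is the open cone on the `j`-skeleton of `L`. -/
def skeleton {L : Type u} (F : ℕ → Set L) : ℕ → Set (OpenCone L)
  | 0 => {vertex L}
  | j + 1 => {c | c = vertex L ∨ ∃ v ∈ F j, ∃ s, c = mk v s}

end OpenCone

/-! ### Topological stratified pseudomanifolds -/

/-- A filtered space `Q = F (l+n) ⊋ F (l+n-1) ⊇ ⋯ ⊇ F l ⊋ ∅` of length `n`, where `F k` is the
`k`-skeleton. Only the values `F k` with `k ≤ l + n` matter. -/
structure IsFilteredSpace (l n : ℕ) (Q : Type u) [TopologicalSpace Q] (F : ℕ → Set Q) :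
    Prop where
  t2 : T2Space Q
  isClosed : ∀ k ≤ l + n, IsClosed (F k)
  mono : ∀ j k, j ≤ k → k ≤ l + n → F j ⊆ F k
  top : F (l + n) = Set.univ
  top_proper : ∀ k < l + n, F k ≠ Set.univ
  bot_nonempty : (F l).Nonempty
  bot_empty : ∀ k < l, F k = ∅

/-- The difference of the `k`-skeleton and the skeleton below it. Its connected components are
the `k`-dimensional strata. -/
def stratumUnion {Q : Type u} (F : ℕ → Set Q) (k : ℕ) : Set Q :=
  {p | p ∈ F k ∧ ∀ j < k, p ∉ F j}

/-- `(Q, F)` is an `(l+n)`-dimensional topological stratified pseudomanifold (with lowest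
skeleton in dimension `l`, and of length `n`). -/
def IsStratifiedPseudomanifold (l n : ℕ) (Q : Type u) [TopologicalSpace Q] (F : ℕ → Set Q) :
    Prop :=
  IsFilteredSpace l n Q F ∧
  (l + n = 0 → DiscreteTopology Q) ∧
  (l + n ≠ 0 →
    -- every stratum of dimension `l + i` is a manifold of that dimension
    (∀ i ≤ n, ∀ p ∈ stratumUnion F (l + i),
      IsTopManifold (l + i) (connectedComponentIn (stratumUnion F (l + i)) p)) ∧
    -- the union of the top strata is dense
    Dense (stratumUnion F (l + n)) ∧
    -- every point has a conical chart whose link is empty or a compact topological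
    -- stratified pseudomanifold of dimension `n - i - 1`
    ∀ i ≤ n, ∀ p ∈ stratumUnion F (l + i),
      ∃ (U : Set Q) (L : Type u) (_ : TopologicalSpace L) (FL : ℕ → Set L)
        (O : Set (EuclideanSpace ℝ (Fin (l + i)))) (φ : U ≃ₜ O × OpenCone L),
        IsOpen U ∧ p ∈ U ∧
        CompactSpace L ∧
        (IsEmpty L ∨ ∃ (l' n' : ℕ) (_ : l' + n' + i + 1 = n),
          IsStratifiedPseudomanifold l' n' L FL) ∧
        IsOpen O ∧ ContractibleSpace O ∧
        ∀ k ≤ n - i, ∀ y : U,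
          (y : Q) ∈ F (l + i + k) ↔ (φ y).2 ∈ OpenCone.skeleton FL k)
termination_by l + n

/-! ### Torus actions -/

/-- The torus `T^m = U(1)^m`. -/
abbrev Torus (m : ℕ) : Type := Fin m → Circle

/-- The orbit of `x` has dimension `j`, that is, the isotropy subgroup of `x` is a torus of
dimension `m - j`. -/
def OrbitHasDim (m : ℕ) {X : Type u} [MulAction (Torus m) X] (x : X) (j : ℕ) : Prop :=
  ∃ k : ℕ, j + k = m ∧ Nonempty (MulAction.stabilizer (Torus m) x ≃ₜ* Torus k)

/-- The filtration by orbit dimension: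
`X_{l+2i+(m-n)} = X_{l+2i+1+(m-n)} = {x | dim T(x) ≤ i + (m-n)}`, and `X_k = ∅` for
`k < l + (m-n)`. -/
def orbitFiltration (l m n : ℕ) (X : Type u) [MulAction (Torus m) X] (k : ℕ) : Set X :=
  {x | l + (m - n) ≤ k ∧
    ∃ j ≤ (k - (l + (m - n))) / 2 + (m - n), OrbitHasDim m x j}

/-- The induced filtration of the orbit space: `Q_{l+i} = X_{l+2i+(m-n)} / T`, and `Q_k = ∅` for
`k < l`. -/
def orbitSpaceFiltration (l m n : ℕ) (X : Type u) [MulAction (Torus m) X] (k : ℕ) :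
    Set (MulAction.orbitRel.Quotient (Torus m) X) :=
  {q | l ≤ k ∧ ∃ x ∈ orbitFiltration l m n X (l + 2 * (k - l) + (m - n)),
    (Quotient.mk _ x : MulAction.orbitRel.Quotient (Torus m) X) = q}

/-- The standing assumptions on a `T^m`-space `X` with its filtration by orbit dimension. -/
structure IsFilteredTorusSpace (l m n : ℕ) (X : Type u) [TopologicalSpace X]
    [MulAction (Torus m) X] : Prop where
  le : n ≤ m
  t2 : T2Space X
  compact : CompactSpace X
  secondCountable : SecondCountableTopology X
  continuous : ContinuousSMul (Torus m) X
  effective : FaithfulSMul (Torus m) X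
  /-- All isotropy subgroups are subtori, i.e. closed connected subgroups. -/
  isotropy : ∀ x : X, IsClosed (MulAction.stabilizer (Torus m) x : Set (Torus m)) ∧
    IsConnected (MulAction.stabilizer (Torus m) x : Set (Torus m))
  pseudomanifold :
    IsStratifiedPseudomanifold (l + (m - n)) (2 * n) X (orbitFiltration l m n X)
  /-- There are no orbits of dimension less than `m - n`. -/
  orbit_dim : ∀ (x : X) (j : ℕ), OrbitHasDim m x j → m - n ≤ j
  /-- There are free orbits. -/
  free : l + n ≠ 0 → ∃ x : X, MulAction.stabilizer (Torus m) x = ⊥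

/-- `X` is an `(l+m+n)`-dimensional locally standard `T^m`-pseudomanifold. -/
def IsLocallyStandard (l m n : ℕ) (X : Type u) [TopologicalSpace X] [MulAction (Torus m) X] :
    Prop :=
  IsFilteredTorusSpace l m n X ∧
  -- base case: a finite disjoint union of tori with the multiplicative action
  (l + n = 0 → ∃ (r : ℕ) (e : X ≃ₜ Fin r × Torus m),
    ∀ (t : Torus m) (x : X), e (t • x) = ((e x).1, t * (e x).2)) ∧
  (l + n ≠ 0 → ∀ i ≤ n, ∀ x : X, OrbitHasDim m x (i + (m - n)) →
    ∃ (U : Set X) (hU : ∀ (t : Torus m), ∀ y ∈ U, t • y ∈ U)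
      (L : Type u) (_ : TopologicalSpace L) (_ : MulAction (Torus (n - i)) L)
      (O : Set (EuclideanSpace ℝ (Fin l))) (Ω : Set (Fin i → ℂ))
      (φ : U ≃ₜ O × (Ω × Torus (m - n)) × OpenCone L)
      -- the identification `T^m ≅ T^m / T_x × T_x ≅ U(1)^{i+(m-n)} × T^{n-i}`
      (α : Torus m ≃ₜ* (Torus i × Torus (m - n)) × Torus (n - i)),
      IsOpen U ∧ x ∈ U ∧
      -- the link is empty or a locally standard `T_x`-pseudomanifold of dimension `2n-2i-1`
      (IsEmpty L ∨ ∃ (l' n' : ℕ) (_ : l' + (n - i) + n' + 1 = 2 * (n - i)),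
        IsLocallyStandard l' (n - i) n' L) ∧
      IsOpen O ∧ ContractibleSpace O ∧
      IsOpen Ω ∧ (∀ w ∈ Ω, ∀ j, w j ≠ 0) ∧
      (∀ t : Torus i, ∀ w ∈ Ω, (fun j => (t j : ℂ) * w j) ∈ Ω) ∧
      (∀ t : Torus m, t ∈ MulAction.stabilizer (Torus m) x ↔ (α t).1 = 1) ∧
      -- `φ` is equivariant along `α`
      ∀ (t : Torus m) (y : U),
        (φ ⟨t • (y : X), hU t y y.2⟩).1 = (φ y).1 ∧
        ((φ ⟨t • (y : X), hU t y y.2⟩).2.1.1 : Fin i → ℂ) =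
          (fun j => ((α t).1.1 j : ℂ) * ((φ y).2.1.1 : Fin i → ℂ) j) ∧
        (φ ⟨t • (y : X), hU t y y.2⟩).2.1.2 = (α t).1.2 * (φ y).2.1.2 ∧
        (φ ⟨t • (y : X), hU t y y.2⟩).2.2 =
          OpenCone.map (fun v => (α t).2 • v) (φ y).2.2)
termination_by l + n
decreasing_by omega

/-- `X` is a locally standard `T^m`-pseudomanifold over a graph: it is connected, `l = 0`,
`n = 1`, and `dim X = m + 1 ≤ 3`. -/
structure IsLocallyStandardOverGraph (m : ℕ) (X : Type u) [TopologicalSpace X]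
    [MulAction (Torus m) X] : Prop where
  connected : ConnectedSpace X
  dim_le : 0 + m + 1 ≤ 3
  locallyStandard : IsLocallyStandard 0 m 1 X

/-- A graph, given as a space `Q` with its set `V` of vertices, is an interval: it consists of a
single edge joining two distinct vertices. -/
def IsIntervalGraph (Q : Type u) [TopologicalSpace Q] (V : Set Q) : Prop :=
  ∃ h : Q ≃ₜ unitInterval, h '' V = {0, 1}

/-! Since `m ≤ 2`, the spaces in question have dimension 2 or 3, and everything is decided near the
orbits of dimension `m - 1`. Near a free orbit, `X` looks like `Ω × T^(m-1)` with `Ω ⊂ ℂ \ {0}`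
open. So `X` is locally Euclidean of dimension `m + 1` there, and the modulus on `Ω` makes the orbit
space an open interval. Near an orbit of dimension `m - 1`, `X` looks like `T^(m-1) × c(L)`, where
`L` is a union of `r` circles permuted freely by `T^1` within each circle; the orbit space is then a
star with `r` edges. Connectedness and the existence of a free orbit give `r ≥ 1`
(`VertexChart.nonempty_link`). Both sides of the equivalence amount to `r = 1` at every vertex.

If `r = 1`, then `c(L)` is an open disc and `X` is locally Euclidean at the vertex orbit. If `r ≥
2`, let the signed height on `c(L)` be positive on one sheet and negative on the others. For `m = 1`
it retracts a neighbourhood of the point `p` onto a real interval with only `p` over `0`, so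
deleting `p` disconnects small neighbourhoods. For `m = 2`, the signed height together with the
angle along the orbit retracts a neighbourhood onto a disc in `ℂ` with only `p` over `0`; the
resulting nonvanishing function on the punctured neighbourhood has no logarithm. In `ℝ^d` the first
is impossible for `d ≥ 2` and the second for `d ≥ 3`. The dimension of the manifold is not
prescribed, but the same two invariants, evaluated at a free orbit, give `d ≥ m + 1`. Hence a
manifold has `r = 1` everywhere.

If `r = 1` everywhere, `Q` is a compact connected Hausdorff space with open interval charts and, at
the nonempty set of vertices, half-open ones. By the classification of such spaces
(`isIntervalGraph_of_charts`) it is a closed interval whose end points are the vertices. Conversely,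
in an interval graph every vertex is an end point; a star with `r ≥ 2` edges would contain an
injective path through it, which is impossible by monotonicity. So `r = 1` and `X` is a manifold. -/

open Set Filter Topology

/-! ### Punctured neighbourhoods -/

section Punctured

variable {X : Type*} {Y : Type*} [TopologicalSpace X] [TopologicalSpace Y]

/-- The point `p` has arbitrarily small neighbourhoods which stay connected without `p`. -/
def PuncturedConnected (p : X) : Prop :=
  ∀ N ∈ 𝓝 p, ∃ V ∈ 𝓝 p, V ⊆ N ∧ IsPreconnected (V \ {p})

/-- Every nowhere vanishing continuous function near `p`, not necessarily defined at `p`, has a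
continuous logarithm near `p`. -/
def PuncturedLog (p : X) : Prop :=
  ∀ N ∈ 𝓝 p, ∀ f : X → ℂ, ContinuousOn f (N \ {p}) → (∀ y ∈ N \ {p}, f y ≠ 0) →
    ∃ V ∈ 𝓝 p, V ⊆ N ∧ ∃ θ : X → ℂ, ContinuousOn θ (V \ {p}) ∧
      ∀ y ∈ V \ {p}, Complex.exp (θ y) = f y

/-- A neighbourhood of `p` retracts onto a copy of a neighbourhood of `0` in `F`, with only `p`
sent to `0`. -/
def HasLocalRetraction (F : Type*) [TopologicalSpace F] [Zero F] (p : X) : Prop :=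
  ∃ N ∈ 𝓝 p, ∃ g : X → F, ContinuousOn g N ∧ (∀ y ∈ N, g y = 0 → y = p) ∧
    ∃ σ : F → X, σ 0 = p ∧ ∃ D ∈ 𝓝 (0 : F), ContinuousOn σ D ∧ ∀ z ∈ D, σ z ∈ N ∧ g (σ z) = z

theorem OpenPartialHomeomorph.inter_preimage_mem_nhds (φ : OpenPartialHomeomorph X Y) {p : X}
    (hp : p ∈ φ.source) {V : Set Y} (hV : V ∈ 𝓝 (φ p)) : φ.source ∩ φ ⁻¹' V ∈ 𝓝 p :=
  inter_mem (φ.open_source.mem_nhds hp) ((φ.continuousAt hp).preimage_mem_nhds hV)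

theorem OpenPartialHomeomorph.target_inter_preimage_mem_nhds (φ : OpenPartialHomeomorph X Y)
    {p : X} (hp : p ∈ φ.source) {N : Set X} (hN : N ∈ 𝓝 p) :
    φ.target ∩ φ.symm ⁻¹' N ∈ 𝓝 (φ p) := by
  refine φ.symm.inter_preimage_mem_nhds (φ.map_source hp) ?_
  rwa [φ.left_inv hp]

theorem PuncturedConnected.of_chart (φ : OpenPartialHomeomorph X Y) {p : X} (hp : p ∈ φ.source)
    (h : PuncturedConnected (φ p)) : PuncturedConnected p := by
  intro N hN
  obtain ⟨V, hV, hVN, hc⟩ := h _ (φ.target_inter_preimage_mem_nhds hp hN)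
  refine ⟨φ.source ∩ φ ⁻¹' V, φ.inter_preimage_mem_nhds hp hV, ?_, ?_⟩
  · rintro x ⟨hx, hxV⟩
    have := (hVN hxV).2
    rwa [mem_preimage, φ.left_inv hx] at this
  · have : (φ.source ∩ φ ⁻¹' V) \ {p} = φ.symm '' (V \ {φ p}) := by
      ext x
      constructor
      · rintro ⟨⟨hx, hxV⟩, hxp⟩
        refine ⟨φ x, ⟨hxV, fun h => hxp (φ.injOn hx hp h)⟩, φ.left_inv hx⟩
      · rintro ⟨y, ⟨hyV, hyp⟩, rfl⟩
        have hy := (hVN hyV).1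
        refine ⟨⟨φ.map_target hy, ?_⟩, fun h => hyp ?_⟩
        · rwa [mem_preimage, φ.right_inv hy]
        · rw [mem_singleton_iff] at h ⊢
          rw [← h, φ.right_inv hy]
    rw [this]
    exact hc.image _ (φ.symm.continuousOn.mono fun y hy => (hVN hy.1).1)

theorem PuncturedLog.of_chart (φ : OpenPartialHomeomorph X Y) {p : X} (hp : p ∈ φ.source)
    (h : PuncturedLog (φ p)) : PuncturedLog p := by
  intro N hN f hf hf0
  have key : ∀ y ∈ (φ.target ∩ φ.symm ⁻¹' N) \ {φ p}, φ.symm y ∈ N \ {p} := by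
    rintro y ⟨⟨hy, hyN⟩, hyp⟩
    exact ⟨hyN, fun h => hyp (by rw [mem_singleton_iff] at h ⊢; rw [← h, φ.right_inv hy])⟩
  obtain ⟨V, hV, hVN, θ, hθ, hexp⟩ := h _ (φ.target_inter_preimage_mem_nhds hp hN) (f ∘ φ.symm)
    (hf.comp (φ.symm.continuousOn.mono fun y hy => hy.1.1) key) fun y hy => hf0 _ (key y hy)
  have key' : ∀ x ∈ (φ.source ∩ φ ⁻¹' V) \ {p}, φ x ∈ V \ {φ p} := by
    rintro x ⟨⟨hx, hxV⟩, hxp⟩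
    exact ⟨hxV, fun h => hxp (φ.injOn hx hp h)⟩
  refine ⟨φ.source ∩ φ ⁻¹' V, φ.inter_preimage_mem_nhds hp hV, ?_, θ ∘ φ,
    hθ.comp (φ.continuousOn.mono fun x hx => hx.1.1) key', ?_⟩
  · rintro x ⟨hx, hxV⟩
    have := (hVN hxV).2
    rwa [mem_preimage, φ.left_inv hx] at this
  · intro x hx
    simpa [φ.left_inv hx.1.1] using hexp _ (key' x hx)

/-- The retraction avoids `0` off `p`, yet the section supplies values of both signs arbitrarily
near `p`. A connected punctured neighbourhood would have an interval as image, which would contain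
`0`. -/
theorem HasLocalRetraction.not_puncturedConnected {p : X} (h : HasLocalRetraction ℝ p) :
    ¬ PuncturedConnected p := by
  obtain ⟨N, hN, g, hg, hg0, σ, hσ0, D, hD, hσ, hσg⟩ := h
  intro hp
  obtain ⟨V, hV, hVN, hc⟩ := hp N hN
  have h1 : ∀ᶠ z in 𝓝 (0 : ℝ), z ∈ D ∧ σ z ∈ V :=
    Filter.Eventually.and hD
      ((hσ.continuousAt hD).preimage_mem_nhds (by rw [hσ0]; exact hV))
  obtain ⟨ε, hε, hb⟩ := Metric.eventually_nhds_iff.1 h1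
  have hmem : ∀ z : ℝ, z ≠ 0 → |z| < ε → z ∈ g '' (V \ {p}) := by
    intro z hz hzε
    obtain ⟨hzD, hzV⟩ := hb (y := z) (by simpa using hzε)
    refine ⟨σ z, ⟨hzV, fun h => hz ?_⟩, (hσg z hzD).2⟩
    have h0 := (hσg 0 (mem_of_mem_nhds hD)).2
    rw [mem_singleton_iff] at h
    rw [← (hσg z hzD).2, h, ← hσ0, h0]
  have hpre := (hc.image g (hg.mono fun y hy => hVN hy.1)).ordConnected
  have h2 : (0 : ℝ) ∈ g '' (V \ {p}) :=
    hpre.out (hmem (-(ε / 2)) (by linarith) (by rw [abs_neg, abs_of_pos] <;> linarith))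
      (hmem (ε / 2) (by linarith) (by rw [abs_of_pos] <;> linarith))
      ⟨by linarith, by linarith⟩
  obtain ⟨y, hy, hy0⟩ := h2
  exact hy.2 (hg0 y (hVN hy.1) hy0)

/-- Along `r e^{it}`, the function `θ - it` lifts the constant `r` through the covering `exp`, hence
is constant. Going once around the circle returns to the same `θ` but changes `it` by `2πi`. -/
theorem not_exists_log_on_circle {r : ℝ} (hr : 0 < r) (θ : ℂ → ℂ)
    (hθ : ContinuousOn θ (Metric.sphere 0 r)) :
    ¬ ∀ z ∈ Metric.sphere (0 : ℂ) r, Complex.exp (θ z) = z := by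
  intro h
  have hmem : ∀ t : ℝ, (r : ℂ) * Complex.exp (t * Complex.I) ∈ Metric.sphere (0 : ℂ) r := by
    intro t
    simp [Complex.norm_exp_ofReal_mul_I, abs_of_pos hr]
  have hc : Continuous fun t : ℝ => θ (r * Complex.exp (t * Complex.I)) - t * Complex.I := by
    refine (hθ.comp_continuous (by fun_prop) hmem).sub (by fun_prop)
  have hr0 : (r : ℂ) ≠ 0 := by exact_mod_cast hr.ne'
  have hexp : ∀ t : ℝ,
      Complex.exp (θ (r * Complex.exp (t * Complex.I)) - t * Complex.I) = r := by
    intro t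
    rw [Complex.exp_sub, h _ (hmem t), mul_div_assoc, div_self (Complex.exp_ne_zero _), mul_one]
  have hconst : ∀ t : ℝ, θ (r * Complex.exp (t * Complex.I)) - t * Complex.I =
      θ (r * Complex.exp ((0 : ℝ) * Complex.I)) - (0 : ℝ) * Complex.I := by
    intro t
    have := (Complex.isCoveringMap_exp.isSeparatedMap).eq_of_comp_eq
      Complex.isCoveringMap_exp.isLocalHomeomorph.isLocallyInjective hc
      (g₂ := fun _ => θ (r * Complex.exp ((0 : ℝ) * Complex.I)) - (0 : ℝ) * Complex.I)
      continuous_const (by ext s; simp only [Function.comp]; rw [hexp s, hexp 0]) 0 rfl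
    exact congrFun this t
  have h1 := hconst (2 * Real.pi)
  simp [Complex.exp_two_pi_mul_I] at h1

/-- A logarithm of the retraction, composed with the section, would be a logarithm of the identity
on a small circle around `0`. -/
theorem HasLocalRetraction.not_puncturedLog {p : X} (h : HasLocalRetraction ℂ p) :
    ¬ PuncturedLog p := by
  obtain ⟨N, hN, g, hg, hg0, σ, hσ0, D, hD, hσ, hσg⟩ := h
  intro hp
  obtain ⟨V, hV, hVN, θ, hθ, hexp⟩ := hp N hN g (hg.mono sdiff_subset)
    fun y hy h0 => hy.2 (hg0 y hy.1 h0)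
  have h1 : ∀ᶠ z in 𝓝 (0 : ℂ), z ∈ D ∧ σ z ∈ V :=
    Filter.Eventually.and hD
      ((hσ.continuousAt hD).preimage_mem_nhds (by rw [hσ0]; exact hV))
  obtain ⟨ε, hε, hb⟩ := Metric.eventually_nhds_iff.1 h1
  have hmem : ∀ z ∈ Metric.sphere (0 : ℂ) (ε / 2), z ∈ D ∧ σ z ∈ V \ {p} := by
    intro z hz
    have hz' : ‖z‖ = ε / 2 := by simpa using hz
    obtain ⟨hzD, hzV⟩ := hb (y := z) (by rw [dist_zero_right]; linarith)
    refine ⟨hzD, hzV, fun h => ?_⟩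
    have h0 := (hσg 0 (mem_of_mem_nhds hD)).2
    rw [mem_singleton_iff] at h
    have : z = 0 := by rw [← (hσg z hzD).2, h, ← hσ0, h0]
    rw [this, norm_zero] at hz'
    linarith
  refine not_exists_log_on_circle (half_pos hε) (θ ∘ σ)
    (hθ.comp (hσ.mono fun z hz => (hmem z hz).1) fun z hz => (hmem z hz).2) fun z hz => ?_
  rw [Function.comp, hexp _ (hmem z hz).2, (hσg z (hmem z hz).1).2]

theorem HasLocalRetraction.zero {F : Type*} [TopologicalSpace F] [Zero F] :
    HasLocalRetraction F (0 : F) :=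
  ⟨univ, univ_mem, id, continuousOn_id, fun _ _ h => h, id, rfl, univ, univ_mem, continuousOn_id,
    fun _ _ => ⟨mem_univ _, rfl⟩⟩

end Punctured

/-! ### Punctured balls in normed spaces -/

/-- The part of the ball of radius `r` in `ℝ × E` off the ray of the points `(-s t, 0)`, `t ≥ 0`. -/
def slitBall (E : Type*) [NormedAddCommGroup E] (r s : ℝ) : Set (ℝ × E) :=
  {p | p ∈ Metric.ball (0 : ℝ × E) r ∧ (p.2 ≠ 0 ∨ 0 < s * p.1)}

theorem isOpen_slitBall {E : Type*} [NormedAddCommGroup E] (r s : ℝ) : IsOpen (slitBall E r s) := by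
  refine Metric.isOpen_ball.inter (IsOpen.union ?_ ?_)
  · exact isOpen_ne.preimage continuous_snd
  · exact isOpen_lt continuous_const (continuous_const.mul continuous_fst)

section NormedSpace

variable {E : Type*} [NormedAddCommGroup E] [NormedSpace ℝ E]

theorem isPreconnected_ball_diff_center (hE : 1 < Module.rank ℝ E) {r : ℝ} (hr : 0 < r) :
    IsPreconnected (Metric.ball (0 : E) r \ {0}) := by
  have h := (isConnected_compl_singleton_of_one_lt_rank hE (0 : E)).isPreconnected
  have h2 := h.image (OpenPartialHomeomorph.univBall (0 : E) r)
    (OpenPartialHomeomorph.continuous_univBall (0 : E) r).continuousOn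
  convert h2 using 1
  have hs := OpenPartialHomeomorph.univBall_source (0 : E) r
  ext x
  constructor
  · rintro ⟨hx, hx0⟩
    rw [← OpenPartialHomeomorph.univBall_target (0 : E) hr] at hx
    refine ⟨(OpenPartialHomeomorph.univBall (0 : E) r).symm x, fun h => hx0 ?_,
      OpenPartialHomeomorph.right_inv _ hx⟩
    rw [mem_singleton_iff] at h ⊢
    rw [← OpenPartialHomeomorph.right_inv _ hx, h, OpenPartialHomeomorph.univBall_apply_zero]
  · rintro ⟨y, hy, rfl⟩
    refine ⟨?_, fun h => hy ?_⟩
    · rw [← OpenPartialHomeomorph.univBall_target (0 : E) hr]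
      exact OpenPartialHomeomorph.map_source _ (by rw [hs]; trivial)
    · refine (OpenPartialHomeomorph.univBall (0 : E) r).injOn (by rw [hs]; trivial)
        (by rw [hs]; trivial) ?_
      rw [OpenPartialHomeomorph.univBall_apply_zero]
      exact h

theorem puncturedConnected_zero (hE : 1 < Module.rank ℝ E) : PuncturedConnected (0 : E) := by
  intro N hN
  obtain ⟨r, hr, hb⟩ := Metric.mem_nhds_iff.1 hN
  exact ⟨_, Metric.ball_mem_nhds _ hr, hb, isPreconnected_ball_diff_center hE hr⟩

/-- For `s = ±1`, the set is star-shaped about the point `(s r / 2, 0)`, opposite to the removed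
ray. -/
theorem isSimplyConnected_slitBall {r s : ℝ} (hr : 0 < r) (hs : s * s = 1) :
    IsSimplyConnected (slitBall E r s) := by
  have hs1 : |s| = 1 := by
    have : |s| * |s| = 1 := by rw [← abs_mul, hs, abs_one]
    nlinarith [abs_nonneg s]
  have hball : ((s * (r / 2), 0) : ℝ × E) ∈ Metric.ball (0 : ℝ × E) r := by
    rw [mem_ball_zero_iff, Prod.norm_def]
    simp only [norm_zero, Real.norm_eq_abs, abs_mul, hs1, one_mul]
    rw [abs_of_pos (half_pos hr), max_lt_iff]
    constructor <;> linarith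
  have hpos : 0 < s * (s * (r / 2)) := by rw [← mul_assoc, hs]; linarith
  have hst : StarConvex ℝ ((s * (r / 2), 0) : ℝ × E) (slitBall E r s) := by
    intro p hp a b ha hb hab
    refine ⟨(convex_ball (0 : ℝ × E) r) hball hp.1 ha hb hab, ?_⟩
    rcases hb.eq_or_lt with rfl | hb
    · right
      have : a = 1 := by linarith
      simpa [this] using hpos
    · rcases hp.2 with h | h
      · left
        simpa using ⟨hb.ne', h⟩
      · right
        simp only [Prod.fst_add, Prod.smul_fst, smul_eq_mul]
        have h1 := mul_nonneg ha hpos.le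
        have h2 := mul_pos hb h
        nlinarith
  have hne : (slitBall E r s).Nonempty := ⟨_, hball, Or.inr hpos⟩
  have := hst.contractibleSpace hne
  exact inferInstanceAs (SimplyConnectedSpace (slitBall E r s))

/-- Two slit balls with opposite slits cover the punctured ball. Each is simply connected, so the
function has a logarithm on each. Their overlap is an interval times a punctured ball of `E`,
connected because `dim E ≥ 2`, so the two logarithms differ there by one constant period and can be
glued. -/
theorem puncturedLog_zero (hE : 1 < Module.rank ℝ E) : PuncturedLog (0 : ℝ × E) := by
  intro N hN f hf hf0
  obtain ⟨r, hr, hb⟩ := Metric.mem_nhds_iff.1 hN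
  have hsub : ∀ s, slitBall E r s ⊆ N \ {0} := by
    rintro s p ⟨hp, hp'⟩
    refine ⟨hb hp, ?_⟩
    rintro rfl
    simp at hp'
  have hlog : ∀ s : ℝ, s * s = 1 → ∃ θ : ℝ × E → ℂ, ContinuousOn θ (slitBall E r s) ∧
      EqOn (Complex.exp ∘ θ) f (slitBall E r s) := by
    intro s hs
    refine Complex.exists_continuousOn_eqOn_exp_comp (isSimplyConnected_slitBall hr hs)
      (isOpen_slitBall r s) (hf.mono (hsub s)) ?_
    rintro ⟨p, hp, hp0⟩
    exact hf0 p (hsub s hp) hp0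
  obtain ⟨θ₁, hθ₁, he₁⟩ := hlog 1 (by norm_num)
  obtain ⟨θ₂, hθ₂, he₂⟩ := hlog (-1) (by norm_num)
  have hinter : IsPreconnected (slitBall E r 1 ∩ slitBall E r (-1)) := by
    have : slitBall E r 1 ∩ slitBall E r (-1) =
        Metric.ball (0 : ℝ) r ×ˢ (Metric.ball (0 : E) r \ {0}) := by
      ext ⟨t, y⟩
      simp only [slitBall, mem_inter_iff, mem_ofPred_eq, mem_prod, Set.mem_sdiff, mem_singleton_iff,
        mem_ball_zero_iff, Prod.norm_def, max_lt_iff]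
      constructor
      · rintro ⟨⟨h1, h2⟩, -, h3⟩
        refine ⟨h1.1, h1.2, fun h => ?_⟩
        rcases h2 with h2 | h2
        · exact h2 h
        · rcases h3 with h3 | h3
          · exact h3 h
          · linarith
      · rintro ⟨h1, h2, h3⟩
        exact ⟨⟨⟨h1, h2⟩, Or.inl h3⟩, ⟨h1, h2⟩, Or.inl h3⟩
    rw [this]
    exact Metric.isPreconnected_ball.prod (isPreconnected_ball_diff_center hE hr)
  obtain ⟨c, hc1, hc⟩ : ∃ c : ℂ, Complex.exp c = 1 ∧
      ∀ p ∈ slitBall E r 1 ∩ slitBall E r (-1), θ₁ p - θ₂ p = c := by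
    have hd : ∀ p ∈ slitBall E r 1 ∩ slitBall E r (-1), Complex.exp (θ₁ p - θ₂ p) = 1 := by
      intro p hp
      have h1 : Complex.exp (θ₁ p) = f p := he₁ hp.1
      have h2 : Complex.exp (θ₂ p) = f p := he₂ hp.2
      rw [Complex.exp_sub, h1, h2, div_self (hf0 p (hsub _ hp.1))]
    rcases (slitBall E r 1 ∩ slitBall E r (-1)).eq_empty_or_nonempty with h | ⟨p₀, hp₀⟩
    · exact ⟨0, Complex.exp_zero, by simp [h]⟩
    · refine ⟨θ₁ p₀ - θ₂ p₀, hd p₀ hp₀, fun p hp => ?_⟩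
      have hcont : ContinuousOn (fun p => θ₁ p - θ₂ p) (slitBall E r 1 ∩ slitBall E r (-1)) :=
        (hθ₁.mono inter_subset_left).sub (hθ₂.mono inter_subset_right)
      exact (Complex.isCoveringMap_exp.isSeparatedMap).eqOn_of_comp_eqOn
        Complex.isCoveringMap_exp.isLocalHomeomorph.isLocallyInjective hinter hcont
        continuousOn_const (fun p hp => by
          apply Subtype.ext
          simp only [Function.comp]
          rw [hd p hp, hd p₀ hp₀]) hp₀ rfl hp
  classical
  -- Adding the period `c` to the second branch makes the two agree on the overlap without changing
  -- the exponential.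
  refine ⟨Metric.ball 0 r, Metric.ball_mem_nhds _ hr, hb,
    fun p => if p ∈ slitBall E r 1 then θ₁ p else θ₂ p + c, ?_, ?_⟩
  · intro p hp
    have hcov : p ∈ slitBall E r 1 ∨ p ∈ slitBall E r (-1) := by
      by_cases h2 : p.2 = 0
      · have h1 : p.1 ≠ 0 := fun h1 => hp.2 (Prod.ext h1 h2)
        rcases lt_or_gt_of_ne h1 with h1 | h1
        · exact Or.inr ⟨hp.1, Or.inr (by linarith)⟩
        · exact Or.inl ⟨hp.1, Or.inr (by linarith)⟩
      · exact Or.inl ⟨hp.1, Or.inl h2⟩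
    apply ContinuousAt.continuousWithinAt
    rcases hcov with h | h
    · refine (hθ₁.continuousAt ((isOpen_slitBall r _).mem_nhds h)).congr ?_
      filter_upwards [(isOpen_slitBall r _).mem_nhds h] with q hq
      rw [if_pos hq]
    · refine ((hθ₂.continuousAt ((isOpen_slitBall r _).mem_nhds h)).add
        (continuousAt_const (y := c))).congr ?_
      filter_upwards [(isOpen_slitBall r _).mem_nhds h] with q hq
      by_cases hq1 : q ∈ slitBall E r 1
      · simp only [if_pos hq1, Pi.add_apply, ← hc q ⟨hq1, hq⟩]; ring
      · simp only [if_neg hq1, Pi.add_apply]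
  · intro p hp
    by_cases hq1 : p ∈ slitBall E r 1
    · simp only [if_pos hq1]
      exact he₁ hq1
    · simp only [if_neg hq1]
      have : p ∈ slitBall E r (-1) := by
        refine ⟨hp.1, ?_⟩
        by_contra hcon
        push Not at hcon
        apply hq1
        refine ⟨hp.1, Or.inr ?_⟩
        have h1 : p.1 ≠ 0 := fun h1 => hp.2 (Prod.ext h1 hcon.1)
        have h2 : 0 ≤ p.1 := by linarith [hcon.2]
        rw [one_mul]
        exact lt_of_le_of_ne h2 h1.symm
      rw [Complex.exp_add, hc1, mul_one]
      exact he₂ this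

end NormedSpace

/-! ### Locally Euclidean points and their dimension -/

section Charts

variable {X : Type*} [TopologicalSpace X]

/-- `p` has an open neighbourhood that is homeomorphic to an open subset of `ℝ^d`. -/
def IsLocallyEuclideanAt (d : ℕ) (p : X) : Prop :=
  ∃ φ : OpenPartialHomeomorph X (EuclideanSpace ℝ (Fin d)), p ∈ φ.source

/-- Freedom in the model space allows centred charts in `ℝ`, `ℂ` or `ℝ × E`, whichever the invariant
at hand is computed in. -/
theorem IsLocallyEuclideanAt.exists_chart {d : ℕ} {p : X} (h : IsLocallyEuclideanAt d p)
    (E : Type*) [NormedAddCommGroup E] [NormedSpace ℝ E] [FiniteDimensional ℝ E]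
    (hE : Module.finrank ℝ E = d) :
    ∃ φ : OpenPartialHomeomorph X E, p ∈ φ.source ∧ φ p = 0 := by
  obtain ⟨φ, hφ⟩ := h
  let e : EuclideanSpace ℝ (Fin d) ≃L[ℝ] E := ContinuousLinearEquiv.ofFinrankEq (by simp [hE])
  refine ⟨(φ.transHomeomorph e.toHomeomorph).transHomeomorph (Homeomorph.addRight (-(e (φ p)))),
    by simpa using hφ, ?_⟩
  simp

theorem IsLocallyEuclideanAt.of_chart {d : ℕ} {p : X} {E : Type*} [NormedAddCommGroup E]
    [NormedSpace ℝ E] [FiniteDimensional ℝ E] (φ : OpenPartialHomeomorph X E) (hp : p ∈ φ.source)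
    (hE : Module.finrank ℝ E = d) : IsLocallyEuclideanAt d p := by
  let e : E ≃L[ℝ] EuclideanSpace ℝ (Fin d) := ContinuousLinearEquiv.ofFinrankEq (by simp [hE])
  exact ⟨φ.transHomeomorph e.toHomeomorph, by simpa using hp⟩

theorem IsTopManifold.isLocallyEuclideanAt {X : Type u} [TopologicalSpace X] {d : ℕ}
    (h : IsTopManifold d X) (p : X) : IsLocallyEuclideanAt d p := by
  obtain ⟨c⟩ := h.charted
  exact ⟨chartAt _ p, mem_chart_source _ p⟩

theorem isTopManifold_of_isLocallyEuclideanAt {X : Type u} [TopologicalSpace X] [T2Space X]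
    [SecondCountableTopology X] {d : ℕ} (h : ∀ p : X, IsLocallyEuclideanAt d p) :
    IsTopManifold d X := by
  choose φ hφ using h
  exact ⟨inferInstance, inferInstance, ⟨{
    atlas := range φ
    chartAt := φ
    mem_chart_source := hφ
    chart_mem_atlas := fun p => mem_range_self p }⟩⟩

variable {d : ℕ} {p : X}

theorem IsLocallyEuclideanAt.puncturedConnected (h : IsLocallyEuclideanAt d p) (hd : 2 ≤ d) :
    PuncturedConnected p := by
  obtain ⟨φ, hp, h0⟩ := h.exists_chart (EuclideanSpace ℝ (Fin d)) (by simp)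
  refine .of_chart φ hp ?_
  rw [h0]
  exact puncturedConnected_zero (by
    rw [← Module.finrank_eq_rank, finrank_euclideanSpace_fin]; exact_mod_cast hd)

theorem IsLocallyEuclideanAt.puncturedLog (h : IsLocallyEuclideanAt d p) (hd : 3 ≤ d) :
    PuncturedLog p := by
  obtain ⟨k, rfl⟩ : ∃ k, d = 1 + k := ⟨d - 1, by omega⟩
  obtain ⟨φ, hp, h0⟩ := h.exists_chart (ℝ × EuclideanSpace ℝ (Fin k)) (by simp)
  refine .of_chart φ hp ?_
  rw [h0]
  exact puncturedLog_zero (by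
    rw [← Module.finrank_eq_rank, finrank_euclideanSpace_fin]; exact_mod_cast (by omega : 1 < k))

theorem IsLocallyEuclideanAt.not_puncturedConnected (h : IsLocallyEuclideanAt 1 p) :
    ¬ PuncturedConnected p := by
  obtain ⟨φ, hp, h0⟩ := h.exists_chart ℝ (by simp)
  intro h
  rw [← φ.left_inv hp, h0] at h
  have h0' : (0 : ℝ) ∈ φ.target := h0 ▸ φ.map_source hp
  exact HasLocalRetraction.zero.not_puncturedConnected (h.of_chart φ.symm h0')

theorem IsLocallyEuclideanAt.not_puncturedLog (h : IsLocallyEuclideanAt 2 p) :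
    ¬ PuncturedLog p := by
  obtain ⟨φ, hp, h0⟩ := h.exists_chart ℂ (by simp)
  intro h
  rw [← φ.left_inv hp, h0] at h
  have h0' : (0 : ℂ) ∈ φ.target := h0 ▸ φ.map_source hp
  exact HasLocalRetraction.zero.not_puncturedLog (h.of_chart φ.symm h0')

/-- Dimension zero is detected by isolated points, since a singleton has empty interior in a
Euclidean space of positive dimension. -/
theorem IsLocallyEuclideanAt.eq_zero_iff (h : IsLocallyEuclideanAt d p) :
    d = 0 ↔ IsOpen {p} := by
  obtain ⟨φ, hp, h0⟩ := h.exists_chart (EuclideanSpace ℝ (Fin d)) (by simp)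
  constructor
  · rintro rfl
    convert φ.open_source
    ext x
    simp only [mem_singleton_iff]
    exact ⟨fun h => h ▸ hp, fun hx => φ.injOn hx hp (Subsingleton.elim _ _)⟩
  · intro ho
    have h1 := φ.isOpen_image_of_subset_source ho (by simpa using hp)
    rw [image_singleton, h0] at h1
    by_contra hd
    have : Nonempty (Fin d) := ⟨⟨0, by omega⟩⟩
    have := h1.interior_eq
    rw [interior_singleton] at this
    simp at this

/-- A special case of the invariance of dimension. -/
theorem IsLocallyEuclideanAt.le_of_le_three {k : ℕ} (h : IsLocallyEuclideanAt d p)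
    (hk : IsLocallyEuclideanAt k p) (hk3 : k ≤ 3) : k ≤ d := by
  by_contra! hlt
  -- Dimension 0 is excluded by isolatedness, 1 by connectedness of punctured neighbourhoods, 2 by
  -- existence of logarithms; each invariant separates that dimension from all larger ones.
  have h0 : d ≠ 0 := fun h0 => by
    have := hk.eq_zero_iff.2 (h.eq_zero_iff.1 h0)
    omega
  have h1 : d ≠ 1 := by
    rintro rfl
    exact h.not_puncturedConnected (hk.puncturedConnected (by omega))
  have h2 : d ≠ 2 := by
    rintro rfl
    exact h.not_puncturedLog (hk.puncturedLog (by omega))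
  omega

end Charts

/-! ### Arcs -/

/-- A continuous injective function on an open interval is strictly monotone, so it has no interior
minimum. This is what distinguishes end points from inner points. -/
theorem not_le_of_injOn_Ioo {f : ℝ → ℝ} {u v t : ℝ} (hc : ContinuousOn f (Ioo u v))
    (hi : InjOn f (Ioo u v)) (ht : t ∈ Ioo u v) : ¬ ∀ s ∈ Ioo u v, f t ≤ f s := by
  intro h
  have hl : (u + t) / 2 ∈ Ioo u v := ⟨by linarith [ht.1], by linarith [ht.1, ht.2]⟩
  have hr : (t + v) / 2 ∈ Ioo u v := ⟨by linarith [ht.1, ht.2], by linarith [ht.2]⟩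
  rcases hc.strictMonoOn_of_injOn_Ioo (ht.1.trans ht.2) hi with hm | hm
  · exact (h _ hl).not_gt (hm hl ht (by linarith [ht.1]))
  · exact (h _ hr).not_gt (hm ht hr (by linarith [ht.2]))

theorem not_ge_of_injOn_Ioo {f : ℝ → ℝ} {u v t : ℝ} (hc : ContinuousOn f (Ioo u v))
    (hi : InjOn f (Ioo u v)) (ht : t ∈ Ioo u v) : ¬ ∀ s ∈ Ioo u v, f s ≤ f t := fun h =>
  not_le_of_injOn_Ioo hc.neg (fun _ hx _ hy hxy => hi hx hy (neg_injective hxy)) ht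
    fun s hs => neg_le_neg (h s hs)

section Arcs

variable {Q : Type*} [TopologicalSpace Q]

/-- `σ` is a homeomorphism of `I ⊆ ℝ` onto an open subset of `Q`, with inverse `ρ`. -/
structure IsIntervalChart (I : Set ℝ) (σ : ℝ → Q) (ρ : Q → ℝ) : Prop where
  isOpen : IsOpen (σ '' I)
  cont : ContinuousOn σ I
  cont_inv : ContinuousOn ρ (σ '' I)
  left_inv : ∀ s ∈ I, ρ (σ s) = s

namespace IsIntervalChart

variable {I : Set ℝ} {σ : ℝ → Q} {ρ : Q → ℝ}

theorem right_inv (h : IsIntervalChart I σ ρ) {q : Q} (hq : q ∈ σ '' I) : σ (ρ q) = q := by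
  obtain ⟨s, hs, rfl⟩ := hq
  rw [h.left_inv s hs]

theorem inv_mem (h : IsIntervalChart I σ ρ) {q : Q} (hq : q ∈ σ '' I) : ρ q ∈ I := by
  obtain ⟨s, hs, rfl⟩ := hq
  rwa [h.left_inv s hs]

theorem injOn (h : IsIntervalChart I σ ρ) : InjOn σ I := fun s hs t ht hst => by
  rw [← h.left_inv s hs, hst, h.left_inv t ht]

theorem isOpen_image (h : IsIntervalChart I σ ρ) {W : Set ℝ} (hW : IsOpen W) :
    IsOpen (σ '' (I ∩ W)) := by
  convert h.cont_inv.isOpen_inter_preimage h.isOpen hW using 1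
  ext q
  constructor
  · rintro ⟨s, ⟨hs, hsW⟩, rfl⟩
    exact ⟨⟨s, hs, rfl⟩, by rwa [mem_preimage, h.left_inv s hs]⟩
  · rintro ⟨hq, hqW⟩
    exact ⟨ρ q, ⟨h.inv_mem hq, hqW⟩, h.right_inv hq⟩

theorem restrict (h : IsIntervalChart I σ ρ) {W : Set ℝ} (hW : IsOpen W) :
    IsIntervalChart (I ∩ W) σ ρ :=
  ⟨h.isOpen_image hW, h.cont.mono inter_subset_left,
    h.cont_inv.mono (image_mono inter_subset_left), fun s hs => h.left_inv s hs.1⟩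

theorem neg (h : IsIntervalChart I σ ρ) :
    IsIntervalChart (Neg.neg ⁻¹' I) (fun s => σ (-s)) (fun q => -ρ q) := by
  have him : (fun s => σ (-s)) '' (Neg.neg ⁻¹' I) = σ '' I := by
    ext q
    constructor
    · rintro ⟨s, hs, rfl⟩
      exact ⟨-s, hs, rfl⟩
    · rintro ⟨s, hs, rfl⟩
      exact ⟨-s, by simpa using hs, by simp⟩
  refine ⟨him ▸ h.isOpen, h.cont.comp continuousOn_neg fun s hs => hs, him ▸ h.cont_inv.neg,
    fun s hs => ?_⟩
  rw [h.left_inv _ hs, neg_neg]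

theorem translate (h : IsIntervalChart I σ ρ) (c : ℝ) :
    IsIntervalChart ((fun s => s + c) ⁻¹' I) (fun s => σ (s + c)) (fun q => ρ q - c) := by
  have him : (fun s => σ (s + c)) '' ((fun s => s + c) ⁻¹' I) = σ '' I := by
    ext q
    constructor
    · rintro ⟨s, hs, rfl⟩
      exact ⟨s + c, hs, rfl⟩
    · rintro ⟨s, hs, rfl⟩
      exact ⟨s - c, by simpa using hs, by simp⟩
  refine ⟨him ▸ h.isOpen, h.cont.comp (by fun_prop) fun s hs => hs,
    him ▸ h.cont_inv.sub continuousOn_const, fun s hs => ?_⟩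
  rw [h.left_inv _ hs, add_sub_cancel_right]

end IsIntervalChart

/-- A half-open arc that accumulates at a further point with an interval chart converges to it. -/
theorem tendsto_of_mem_closure_image_Ico [T2Space Q] {a : ℝ} {γ : ℝ → Q} (hc : ContinuousOn γ (Ico 0 a))
    (hi : InjOn γ (Ico 0 a)) {I : Set ℝ} {σ : ℝ → Q} {ρ : Q → ℝ} (h : IsIntervalChart I σ ρ)
    (h0 : 0 ∈ I) (hI : ∃ δ > 0, ∀ ε, 0 < ε → ε < δ → IsCompact (I ∩ Icc (-ε) ε))
    (hcl : σ 0 ∈ closure (γ '' Ico 0 a)) (hn : σ 0 ∉ γ '' Ico 0 a) :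
    Tendsto γ (𝓝[<] a) (𝓝 (σ 0)) := by
  obtain ⟨δ, hδ, hI⟩ := hI
  have ha : 0 < a := by
    by_contra ha
    rw [Ico_eq_empty ha] at hcl
    simp at hcl
  intro N hN
  obtain ⟨ε₀, hε₀, hεN⟩ := Metric.mem_nhdsWithin_iff.1 ((h.cont 0 h0).preimage_mem_nhdsWithin hN)
  obtain ⟨ε, hε, hεlt⟩ := exists_between (lt_min hε₀ hδ)
  have hεN' : σ '' (I ∩ Icc (-ε) ε) ⊆ N := by
    rintro _ ⟨s, ⟨hs, hsε⟩, rfl⟩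
    refine hεN ⟨?_, hs⟩
    rw [mem_ball_zero_iff, Real.norm_eq_abs]
    exact (abs_le.2 hsε).trans_lt (hεlt.trans_le (min_le_left _ _))
  set G := σ '' (I ∩ Ioo (-ε) ε)
  set K := σ '' (I ∩ Icc (-ε) ε)
  have hG : IsOpen G := h.isOpen_image isOpen_Ioo
  have hK : IsClosed K :=
    ((hI ε hε (hεlt.trans_le (min_le_right _ _))).image_of_continuousOn
      (h.cont.mono inter_subset_left)).isClosed
  have hGK : G ⊆ K := image_mono (inter_subset_inter_right _ Ioo_subset_Icc_self)
  have hKG : K \ G ⊆ {σ (-ε), σ ε} := by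
    rintro _ ⟨⟨s, ⟨hs, hsε⟩, rfl⟩, hsG⟩
    rcases hsε.1.eq_or_lt with h1 | h1
    · left; rw [h1]
    rcases hsε.2.eq_or_lt with h2 | h2
    · right; rw [h2]; rfl
    exact absurd ⟨s, ⟨hs, h1, h2⟩, rfl⟩ hsG
  -- `K \ G` has at most two points, so the injective `γ` meets it finitely often and avoids it near
  -- `a`. The remaining tail is connected, hence lies in `G` or outside `K`; accumulation at `σ 0`
  -- rules out the latter.
  have hfin : (Ico 0 a ∩ γ ⁻¹' (K \ G)).Finite := by
    refine Set.Finite.of_finite_image (f := γ) ?_ (hi.mono inter_subset_left)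
    refine ((Set.toFinite {σ (-ε), σ ε}).subset hKG).subset ?_
    rintro _ ⟨t, ht, rfl⟩
    exact ht.2
  have hev : ∀ᶠ t in 𝓝[<] a, t ∉ Ico 0 a ∩ γ ⁻¹' (K \ G) :=
    nhdsWithin_le_nhds (hfin.isClosed.isOpen_compl.mem_nhds fun hmem => lt_irrefl _ hmem.1.2)
  obtain ⟨t₁, ht₁, hsub⟩ := (mem_nhdsLT_iff_exists_Ioo_subset' ha).1 hev
  set t₀ := max t₁ 0
  have ht₀ : t₀ < a := max_lt ht₁ ha
  have h0t₀ : 0 ≤ t₀ := le_max_right _ _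
  have himg : γ '' Ioo t₀ a ⊆ G ∪ Kᶜ := by
    rintro _ ⟨t, ht, rfl⟩
    by_contra hcon
    rw [mem_union, mem_compl_iff, not_or, not_not] at hcon
    exact hsub ⟨(le_max_left _ _).trans_lt ht.1, ht.2⟩ ⟨⟨h0t₀.trans ht.1.le, ht.2⟩, hcon.2, hcon.1⟩
  have hIcc : Icc 0 t₀ ⊆ Ico 0 a := fun t ht => ⟨ht.1, ht.2.trans_lt ht₀⟩
  have hC : IsClosed (γ '' Icc 0 t₀) :=
    (isCompact_Icc.image_of_continuousOn (hc.mono hIcc)).isClosed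
  -- Removing the compact initial piece `γ '' Icc 0 t₀`, which misses `σ 0`, forces the accumulation
  -- to be seen at parameters beyond `t₀`.
  have hqG : σ 0 ∈ G ∩ (γ '' Icc 0 t₀)ᶜ :=
    ⟨⟨0, ⟨h0, by linarith, hε⟩, rfl⟩, fun hmem => hn (image_mono hIcc hmem)⟩
  obtain ⟨_, ⟨hG', hC'⟩, t, ht, rfl⟩ := mem_closure_iff.1 hcl _ (hG.inter hC.isOpen_compl) hqG
  have ht' : t₀ < t := by
    by_contra hle
    exact hC' ⟨t, ⟨ht.1, not_lt.1 hle⟩, rfl⟩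
  have hpre : IsPreconnected (γ '' Ioo t₀ a) :=
    isPreconnected_Ioo.image _ (hc.mono fun s hs => ⟨h0t₀.trans hs.1.le, hs.2⟩)
  have hfinal := hpre.subset_left_of_subset_union hG hK.isOpen_compl
    (disjoint_compl_right.mono_left hGK) himg ⟨γ t, ⟨t, ⟨ht', ht.2⟩, rfl⟩, hG'⟩
  rw [mem_map]
  filter_upwards [Ioo_mem_nhdsLT ht₀] with s hs
  exact hεN' (hGK (hfinal ⟨s, hs, rfl⟩))

theorem continuousOn_update_of_tendsto {a : ℝ} {γ : ℝ → Q} {q : Q}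
    (hc : ContinuousOn γ (Ico 0 a)) (hlim : Tendsto γ (𝓝[<] a) (𝓝 q)) :
    ContinuousOn (Function.update γ a q) (Icc 0 a) := by
  intro t ht
  rcases ht.2.eq_or_lt with rfl | hlt
  · rw [continuousWithinAt_update_same]
    refine hlim.mono_left (nhdsWithin_mono _ ?_)
    rintro s ⟨hs, hst⟩
    exact lt_of_le_of_ne hs.2 hst
  · rw [continuousWithinAt_update_of_ne hlt.ne]
    refine (hc t ⟨ht.1, hlt⟩).mono_of_mem_nhdsWithin ?_
    filter_upwards [self_mem_nhdsWithin, nhdsWithin_le_nhds (Iio_mem_nhds hlt)] with s hs hs'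
    exact ⟨hs.1, hs'⟩

/-- `γ` maps `[0, a)` homeomorphically onto an open subset. -/
structure IsOpenArc (a : ℝ) (γ : ℝ → Q) : Prop where
  pos : 0 < a
  cont : ContinuousOn γ (Ico 0 a)
  inj : InjOn γ (Ico 0 a)
  isOpen : ∀ b ≤ a, IsOpen (γ '' Ico 0 b)

/-- `γ` maps `[0, a]` homeomorphically to `Q`, with the image of `[0, a)` open. -/
structure IsClosedArc (a : ℝ) (γ : ℝ → Q) : Prop where
  pos : 0 < a
  cont : ContinuousOn γ (Icc 0 a)
  inj : InjOn γ (Icc 0 a)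
  isOpen : ∀ b ≤ a, IsOpen (γ '' Ico 0 b)

theorem IsOpenArc.exists_isClosedArc {a : ℝ} {γ : ℝ → Q} (h : IsOpenArc a γ) {q : Q}
    (hlim : Tendsto γ (𝓝[<] a) (𝓝 q)) (hn : q ∉ γ '' Ico 0 a) :
    ∃ γ', IsClosedArc a γ' ∧ γ' a = q ∧ EqOn γ' γ (Ico 0 a) := by
  have heq : EqOn (Function.update γ a q) γ (Ico 0 a) := fun t ht =>
    Function.update_of_ne ht.2.ne _ _
  have ha : Function.update γ a q a = q := Function.update_self ..
  refine ⟨Function.update γ a q, ⟨h.pos, continuousOn_update_of_tendsto h.cont hlim, ?_, ?_⟩,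
    ha, heq⟩
  · rw [← Ico_insert_right h.pos.le, injOn_insert right_notMem_Ico]
    refine ⟨h.inj.congr heq.symm, ?_⟩
    rwa [heq.image_eq, ha]
  · intro b hb
    rw [(heq.mono (Ico_subset_Ico_right hb)).image_eq]
    exact h.isOpen b hb

namespace IsClosedArc

variable {a : ℝ} {γ : ℝ → Q}

theorem isClosed_image [T2Space Q] (h : IsClosedArc a γ) {b : ℝ} (hb : b ≤ a) : IsClosed (γ '' Icc 0 b) :=
  (isCompact_Icc.image_of_continuousOn (h.cont.mono (Icc_subset_Icc_right hb))).isClosed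

theorem image_Icc (h : IsClosedArc a γ) : γ '' Icc 0 a = insert (γ a) (γ '' Ico 0 a) := by
  rw [← Ico_insert_right h.pos.le, image_insert_eq]

variable {I : Set ℝ} {σ : ℝ → Q} {ρ : Q → ℝ}

/-- Reads the last piece of the arc in a chart centred at its end point. Injectivity lets the
coordinate vanish only at `a`, which prepares the intermediate value arguments below. -/
theorem exists_coordinate (h : IsClosedArc a γ) (hσ : IsIntervalChart I σ ρ) (h0 : 0 ∈ I)
    (hq : σ 0 = γ a) :
    ∃ t₀, 0 ≤ t₀ ∧ t₀ < a ∧ (∀ t ∈ Ioc t₀ a, γ t ∈ σ '' I) ∧ ContinuousOn (ρ ∘ γ) (Ioc t₀ a) ∧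
      ρ (γ a) = 0 ∧ ∀ t ∈ Ioo t₀ a, ρ (γ t) ≠ 0 := by
  have hev : γ ⁻¹' (σ '' I) ∈ 𝓝[Icc 0 a] a :=
    (h.cont a (right_mem_Icc.2 h.pos.le)).preimage_mem_nhdsWithin
      (hσ.isOpen.mem_nhds ⟨0, h0, hq⟩)
  rw [nhdsWithin_Icc_eq_nhdsLE h.pos] at hev
  obtain ⟨t₁, ht₁, hsub⟩ := (mem_nhdsLE_iff_exists_Ioc_subset' h.pos).1 hev
  have hmem : ∀ t ∈ Ioc (max t₁ 0) a, γ t ∈ σ '' I := fun t ht =>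
    hsub ⟨(le_max_left _ _).trans_lt ht.1, ht.2⟩
  have hρ : ρ (γ a) = 0 := by rw [← hq, hσ.left_inv 0 h0]
  have hIcc : Ioc (max t₁ 0) a ⊆ Icc 0 a := fun t ht => ⟨(le_max_right _ _).trans ht.1.le, ht.2⟩
  refine ⟨max t₁ 0, le_max_right _ _, max_lt ht₁ h.pos, hmem,
    hσ.cont_inv.comp (h.cont.mono hIcc) hmem, hρ, fun t ht hρt => ?_⟩
  have ht' : t ∈ Ioc (max t₁ 0) a := Ioo_subset_Ioc_self ht
  refine ht.2.ne (h.inj (hIcc ht') (right_mem_Icc.2 h.pos.le) ?_)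
  rw [← hσ.right_inv (hmem t ht'), hρt, hq]

/-- The chart coordinate along the arc falls from a positive value to `0`, so by the intermediate
value theorem the arc fills a whole neighbourhood of its end point in the half-open chart. -/
theorem isOpen_image_Icc (h : IsClosedArc a γ) (hσ : IsIntervalChart (Ico 0 1) σ ρ)
    (hq : σ 0 = γ a) : IsOpen (γ '' Icc 0 a) := by
  obtain ⟨t₀, h0t₀, ht₀, hmem, hcont, hρ, hne⟩ :=
    h.exists_coordinate hσ (left_mem_Ico.2 one_pos) hq
  set t₁ := (t₀ + a) / 2
  have ht₁ : t₁ ∈ Ioo t₀ a := ⟨by simp only [t₁]; linarith, by simp only [t₁]; linarith⟩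
  have hsub : Icc t₁ a ⊆ Ioc t₀ a := fun t ht => ⟨ht₁.1.trans_le ht.1, ht.2⟩
  have hpos : 0 < ρ (γ t₁) :=
    lt_of_le_of_ne (hσ.inv_mem (hmem t₁ (Ioo_subset_Ioc_self ht₁))).1 (hne t₁ ht₁).symm
  have hivt := intermediate_value_Icc' ht₁.2.le (hcont.mono hsub)
  have hnhd : σ '' (Ico 0 1 ∩ Iio (ρ (γ t₁))) ⊆ γ '' Icc 0 a := by
    rintro _ ⟨s, ⟨hs, hslt⟩, rfl⟩
    obtain ⟨t, ht, hts⟩ := hivt (show s ∈ Icc ((ρ ∘ γ) a) ((ρ ∘ γ) t₁) from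
      ⟨by simpa [hρ] using hs.1, (mem_Iio.1 hslt).le⟩)
    refine ⟨t, ⟨h0t₀.trans (hsub ht).1.le, ht.2⟩, ?_⟩
    rw [← hσ.right_inv (hmem t (hsub ht)), ← hts]
    rfl
  have : γ '' Icc 0 a = γ '' Ico 0 a ∪ σ '' (Ico 0 1 ∩ Iio (ρ (γ t₁))) := by
    apply Subset.antisymm
    · rw [h.image_Icc, insert_subset_iff]
      exact ⟨Or.inr ⟨0, ⟨left_mem_Ico.2 one_pos, hpos⟩, hq⟩, subset_union_left⟩
    · exact union_subset (image_mono Ico_subset_Icc_self) hnhd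
  rw [this]
  exact (h.isOpen a le_rfl).union (hσ.isOpen_image isOpen_Iio)

/-- Outside the end point `γ a`, the space is the disjoint union of two open sets: the half-open arc
and the complement of the closed arc. -/
theorem image_subset_of_isPreconnected [T2Space Q] (h : IsClosedArc a γ) {S : Set Q} (hS : IsPreconnected S)
    (hq : γ a ∉ S) (hne : (S ∩ γ '' Ico 0 a).Nonempty) : S ⊆ γ '' Ico 0 a := by
  refine hS.subset_left_of_subset_union (h.isOpen a le_rfl) (h.isClosed_image le_rfl).isOpen_compl
    (disjoint_compl_right.mono_left (image_mono Ico_subset_Icc_self)) (fun q hqS => ?_) hne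
  by_cases hmem : q ∈ γ '' Icc 0 a
  · left
    rw [h.image_Icc] at hmem
    exact hmem.resolve_left fun he => hq (he ▸ hqS)
  · exact Or.inr hmem

/-- The arc enters the chart from the negative side. Then the negative half of the chart already
lies on the arc and the positive half is disjoint from it, so the arc can be continued along the
positive half. -/
theorem exists_extension_of_neg [T2Space Q] (h : IsClosedArc a γ) {c d : ℝ} (hc : 0 < c) (hd : 0 < d)
    (hσ : IsIntervalChart (Ioo (-c) d) σ ρ) (hq : σ 0 = γ a) {t₀ : ℝ} (h0t₀ : 0 ≤ t₀)
    (ht₀ : t₀ < a) (hmem : ∀ t ∈ Ioc t₀ a, γ t ∈ σ '' Ioo (-c) d)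
    (hneg : ∀ t ∈ Ioo t₀ a, ρ (γ t) < 0) :
    ∃ γ', IsOpenArc (a + d) γ' ∧ γ' 0 = γ 0 ∧
      γ '' Ico 0 a ∪ σ '' Ioo (-c) d ⊆ γ' '' Ico 0 (a + d) := by
  classical
  have h0 : (0 : ℝ) ∈ Ioo (-c) d := ⟨by linarith, hd⟩
  have hl : Ioo (-c) 0 ⊆ Ioo (-c) d := Ioo_subset_Ioo_right hd.le
  have hr : Ioo 0 d ⊆ Ioo (-c) d := Ioo_subset_Ioo_left (by linarith)
  set t₁ := (t₀ + a) / 2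
  have ht₁ : t₁ ∈ Ioo t₀ a := ⟨by simp only [t₁]; linarith, by simp only [t₁]; linarith⟩
  have hleft : σ '' Ioo (-c) 0 ⊆ γ '' Ico 0 a := by
    refine h.image_subset_of_isPreconnected (isPreconnected_Ioo.image _ (hσ.cont.mono hl)) ?_ ?_
    · rintro ⟨s, hs, hsq⟩
      exact hs.2.ne (hσ.injOn (hl hs) h0 (hsq.trans hq.symm))
    · have hm := hmem t₁ (Ioo_subset_Ioc_self ht₁)
      exact ⟨γ t₁, ⟨ρ (γ t₁), ⟨(hσ.inv_mem hm).1, hneg t₁ ht₁⟩, hσ.right_inv hm⟩, t₁,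
        ⟨h0t₀.trans ht₁.1.le, ht₁.2⟩, rfl⟩
  -- If the positive half met the arc it would lie on it entirely. Its points near `σ 0` avoid the
  -- compact piece `γ '' Icc 0 t₁`, so they would be late points of the arc, where the coordinate is
  -- negative.
  have hright : ∀ s ∈ Ioo 0 d, σ s ∉ γ '' Ico 0 a := by
    intro s₀ hs₀ hs₀A
    have hsub : σ '' Ioo 0 d ⊆ γ '' Ico 0 a := by
      refine h.image_subset_of_isPreconnected (isPreconnected_Ioo.image _ (hσ.cont.mono hr)) ?_
        ⟨_, ⟨s₀, hs₀, rfl⟩, hs₀A⟩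
      rintro ⟨s, hs, hsq⟩
      exact hs.1.ne' (hσ.injOn (hr hs) h0 (hsq.trans hq.symm))
    have hC := h.isClosed_image ht₁.2.le
    have hqC : σ 0 ∈ (γ '' Icc 0 t₁)ᶜ := by
      rintro ⟨t, ht, htq⟩
      exact (ht.2.trans_lt ht₁.2).ne (h.inj ⟨ht.1, ht.2.trans ht₁.2.le⟩
        (right_mem_Icc.2 h.pos.le) (htq.trans hq))
    have hev : σ ⁻¹' (γ '' Icc 0 t₁)ᶜ ∈ 𝓝 (0 : ℝ) :=
      (hσ.cont.continuousAt (isOpen_Ioo.mem_nhds h0)).preimage_mem_nhds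
        (hC.isOpen_compl.mem_nhds hqC)
    have hev' : ∀ᶠ s in 𝓝[>] (0 : ℝ), s ∈ σ ⁻¹' (γ '' Icc 0 t₁)ᶜ ∧ s ∈ Ioo 0 d :=
      (nhdsWithin_le_nhds hev : _ ∈ 𝓝[>] (0 : ℝ)) |> fun h' => Filter.Eventually.and h'
        (Ioo_mem_nhdsGT hd)
    obtain ⟨s, hsC, hs⟩ := hev'.exists
    obtain ⟨t, ht, hts⟩ := hsub ⟨s, hs, rfl⟩
    have ht' : t ∈ Ioo t₀ a := by
      refine ⟨?_, ht.2⟩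
      by_contra hle
      exact hsC ⟨t, ⟨ht.1, (not_lt.1 hle).trans ht₁.1.le⟩, hts⟩
    have := hneg t ht'
    rw [hts, hσ.left_inv s (hr hs)] at this
    exact this.not_gt hs.1
  set γ' : ℝ → Q := fun t => if t ≤ a then γ t else σ (t - a)
  have hγ'l : ∀ t ≤ a, γ' t = γ t := fun t ht => if_pos ht
  have hγ'r : ∀ t, a ≤ t → γ' t = σ (t - a) := by
    intro t ht
    rcases ht.eq_or_lt with rfl | hlt
    · simp [γ', hq]
    · exact if_neg hlt.not_ge
  have himg : ∀ b, a < b → b ≤ a + d →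
      γ' '' Ico 0 b = γ '' Ico 0 a ∪ σ '' (Ioo (-c) d ∩ Iio (b - a)) := by
    intro b hab hb
    apply Subset.antisymm
    · rintro _ ⟨t, ht, rfl⟩
      rcases lt_or_ge t a with hlt | hge
      · exact Or.inl ⟨t, ⟨ht.1, hlt⟩, (hγ'l t hlt.le).symm⟩
      · refine Or.inr ⟨t - a, ⟨⟨by linarith, by linarith [ht.2]⟩, ?_⟩, (hγ'r t hge).symm⟩
        rw [mem_Iio]
        linarith [ht.2]
    · rintro _ (⟨t, ht, rfl⟩ | ⟨s, ⟨hs, hsb⟩, rfl⟩)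
      · exact ⟨t, ⟨ht.1, ht.2.trans hab⟩, hγ'l t ht.2.le⟩
      · rcases lt_or_ge s 0 with hlt | hge
        · obtain ⟨t, ht, hts⟩ := hleft ⟨s, ⟨hs.1, hlt⟩, rfl⟩
          exact ⟨t, ⟨ht.1, ht.2.trans hab⟩, (hγ'l t ht.2.le).trans hts⟩
        · rw [mem_Iio] at hsb
          refine ⟨s + a, ⟨by linarith [h.pos], by linarith⟩, ?_⟩
          rw [hγ'r _ (by linarith), add_sub_cancel_right]
  refine ⟨γ', ⟨by linarith [h.pos], ?_, ?_, ?_⟩, hγ'l 0 h.pos.le, ?_⟩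
  · have hcov : Ico 0 (a + d) ⊆ Icc 0 a ∪ Ico a (a + d) := fun t ht => by
      rcases le_total t a with hle | hle
      · exact Or.inl ⟨ht.1, hle⟩
      · exact Or.inr ⟨hle, ht.2⟩
    have h1 : ContinuousOn γ' (Icc 0 a) := h.cont.congr fun t ht => hγ'l t ht.2
    have h2 : ContinuousOn γ' (Ico a (a + d)) := by
      refine ContinuousOn.congr (hσ.cont.comp (f := fun t : ℝ => t - a) (by fun_prop) ?_)
        fun t ht => hγ'r t ht.1
      intro t ht
      exact ⟨by linarith [ht.1], by linarith [ht.2]⟩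
    intro t ht
    rcases lt_trichotomy t a with hlt | rfl | hgt
    · refine (h1 t ⟨ht.1, hlt.le⟩).mono_of_mem_nhdsWithin ?_
      filter_upwards [self_mem_nhdsWithin, nhdsWithin_le_nhds (Iio_mem_nhds hlt)] with s hs hs'
      exact ⟨hs.1, (mem_Iio.1 hs').le⟩
    · exact ((h1 t ⟨ht.1, le_rfl⟩).union (h2 t ⟨le_rfl, ht.2⟩)).mono hcov
    · refine (h2 t ⟨hgt.le, ht.2⟩).mono_of_mem_nhdsWithin ?_
      filter_upwards [self_mem_nhdsWithin, nhdsWithin_le_nhds (Ioi_mem_nhds hgt)] with s hs hs'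
      exact ⟨(mem_Ioi.1 hs').le, hs.2⟩
  · have hmix : ∀ t ∈ Icc 0 a, ∀ s, a < s → s < a + d → γ' t ≠ γ' s := by
      intro t ht s hs hsd hts
      rw [hγ'l t ht.2, hγ'r s hs.le] at hts
      rcases ht.2.eq_or_lt with rfl | hlt
      · rw [← hq] at hts
        have := hσ.injOn h0 ⟨by linarith, by linarith⟩ hts
        linarith
      · exact hright (s - a) ⟨by linarith, by linarith⟩ ⟨t, ⟨ht.1, hlt⟩, hts⟩
    intro t ht s hs hts
    rcases le_or_gt t a with hta | hta <;> rcases le_or_gt s a with hsa | hsa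
    · rw [hγ'l t hta, hγ'l s hsa] at hts
      exact h.inj ⟨ht.1, hta⟩ ⟨hs.1, hsa⟩ hts
    · exact absurd hts (hmix t ⟨ht.1, hta⟩ s hsa hs.2)
    · exact absurd hts.symm (hmix s ⟨hs.1, hsa⟩ t hta ht.2)
    · rw [hγ'r t hta.le, hγ'r s hsa.le] at hts
      have := hσ.injOn ⟨by linarith, by linarith [ht.2]⟩ ⟨by linarith, by linarith [hs.2]⟩ hts
      linarith
  · intro b hb
    rcases le_or_gt b a with hba | hba
    · have : γ' '' Ico 0 b = γ '' Ico 0 b :=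
        EqOn.image_eq fun t ht => hγ'l t (ht.2.le.trans hba)
      rw [this]
      exact h.isOpen b hba
    · rw [himg b hba hb]
      exact (h.isOpen a le_rfl).union (hσ.isOpen_image isOpen_Iio)
  · rw [himg (a + d) (by linarith) le_rfl, add_sub_cancel_left]
    exact union_subset_union_right _ (image_mono fun s hs => ⟨hs, hs.2⟩)

/-- The coordinate of the late arc never vanishes, so it has constant sign; when it is positive the
chart is reflected. -/
theorem exists_extension [T2Space Q] (h : IsClosedArc a γ) {c d : ℝ} (hc : 0 < c) (hd : 0 < d)
    (hσ : IsIntervalChart (Ioo (-c) d) σ ρ) (hq : σ 0 = γ a) :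
    ∃ a' γ', IsOpenArc a' γ' ∧ γ' 0 = γ 0 ∧ γ '' Ico 0 a ∪ σ '' Ioo (-c) d ⊆ γ' '' Ico 0 a' := by
  have h0 : (0 : ℝ) ∈ Ioo (-c) d := ⟨by linarith, hd⟩
  obtain ⟨t₀, h0t₀, ht₀, hmem, hcont, hρ, hne⟩ := h.exists_coordinate hσ h0 hq
  have hsign : (∀ t ∈ Ioo t₀ a, ρ (γ t) < 0) ∨ ∀ t ∈ Ioo t₀ a, 0 < ρ (γ t) := by
    by_contra! hcon
    obtain ⟨⟨t, ht, hρt⟩, s, hs, hρs⟩ := hcon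
    have hoc : ((ρ ∘ γ) '' Ioo t₀ a).OrdConnected :=
      (isPreconnected_Ioo.image _ (hcont.mono Ioo_subset_Ioc_self)).ordConnected
    obtain ⟨r, hr, hr0⟩ := hoc.out ⟨s, hs, rfl⟩ ⟨t, ht, rfl⟩ ⟨hρs, hρt⟩
    exact hne r hr hr0
  rcases hsign with hneg | hpos
  · obtain ⟨γ', h1, h2⟩ := h.exists_extension_of_neg hc hd hσ hq h0t₀ ht₀ hmem hneg
    exact ⟨_, γ', h1, h2⟩
  · have hpre : Neg.neg ⁻¹' Ioo (-c) d = Ioo (-d) c := by simp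
    have him : (fun s => σ (-s)) '' Ioo (-d) c = σ '' Ioo (-c) d := by
      rw [← hpre, ← Function.comp_def σ Neg.neg, image_comp, image_preimage_eq _ neg_surjective]
    have hσ' := hσ.neg
    rw [hpre] at hσ'
    obtain ⟨γ', h1, h2⟩ := h.exists_extension_of_neg hd hc hσ' (by simpa using hq) h0t₀ ht₀
      (him ▸ hmem) fun t ht => neg_lt_zero.2 (hpos t ht)
    rw [him] at h2
    exact ⟨_, γ', h1, h2⟩

/-- An inner point of an arc is not an end point for a chart onto `[0, 1)`. -/
theorem ne_of_mem_Ioo (h : IsClosedArc a γ) (hσ : IsIntervalChart (Ico 0 1) σ ρ) {t : ℝ}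
    (ht : t ∈ Ioo 0 a) : γ t ≠ σ 0 := by
  intro hts
  have hnhd : γ ⁻¹' (σ '' Ico 0 1) ∩ Ioo 0 a ∈ 𝓝 t :=
    inter_mem ((h.cont.continuousAt (Icc_mem_nhds ht.1 ht.2)).preimage_mem_nhds
      (hσ.isOpen.mem_nhds ⟨0, left_mem_Ico.2 one_pos, hts.symm⟩)) (Ioo_mem_nhds ht.1 ht.2)
  obtain ⟨u, v, htuv, hsub⟩ := mem_nhds_iff_exists_Ioo_subset.1 hnhd
  have hIcc : Ioo u v ⊆ Icc 0 a := fun s hs => Ioo_subset_Icc_self (hsub hs).2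
  refine not_le_of_injOn_Ioo (f := ρ ∘ γ) (hσ.cont_inv.comp (h.cont.mono hIcc)
    fun s hs => (hsub hs).1) ?_ htuv fun s hs => ?_
  · intro s hs r hr hsr
    refine h.inj (hIcc hs) (hIcc hr) ?_
    rw [← hσ.right_inv (hsub hs).1, ← hσ.right_inv (hsub hr).1]
    exact congrArg σ hsr
  · simp only [Function.comp, hts, hσ.left_inv 0 (left_mem_Ico.2 one_pos)]
    exact (hσ.inv_mem (hsub hs).1).1

theorem exists_homeomorph [T2Space Q] (h : IsClosedArc a γ) (hu : γ '' Icc 0 a = univ) :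
    ∃ e : Q ≃ₜ unitInterval, ∀ t : unitInterval, e.symm t = γ (a * t) := by
  have hmem : ∀ t : unitInterval, a * t ∈ Icc 0 a := fun t =>
    ⟨mul_nonneg h.pos.le t.2.1, mul_le_of_le_one_right h.pos.le t.2.2⟩
  have hc : Continuous fun t : unitInterval => γ (a * t) :=
    h.cont.comp_continuous (by fun_prop) hmem
  have hb : Function.Bijective fun t : unitInterval => γ (a * t) := by
    constructor
    · intro s t hst
      exact Subtype.ext (mul_left_cancel₀ h.pos.ne' (h.inj (hmem s) (hmem t) hst))
    · intro q
      obtain ⟨t, ht, rfl⟩ : q ∈ γ '' Icc 0 a := hu ▸ mem_univ q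
      refine ⟨⟨t / a, div_nonneg ht.1 h.pos.le, (div_le_one h.pos).2 ht.2⟩, ?_⟩
      simp only
      rw [mul_div_cancel₀ _ h.pos.ne']
  let e := Continuous.homeoOfEquivCompactToT2 (f := Equiv.ofBijective _ hb) hc
  exact ⟨e.symm, fun t => rfl⟩

end IsClosedArc

/-- Otherwise compactness would make a single shorter open piece `γ '' Ico 0 b` cover everything,
although it misses `γ b`. -/
theorem IsOpenArc.image_ne_univ [CompactSpace Q] {a : ℝ} {γ : ℝ → Q} (h : IsOpenArc a γ) :
    γ '' Ico 0 a ≠ univ := by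
  intro hu
  have : Nonempty (Iio a) := ⟨⟨0, h.pos⟩⟩
  obtain ⟨⟨b, hb⟩, hbu⟩ := isCompact_univ.elim_directed_cover (fun b : Iio a => γ '' Ico 0 b)
    (fun b => h.isOpen b b.2.le) (by
      intro q hq
      rw [← hu] at hq
      obtain ⟨t, ht, rfl⟩ := hq
      obtain ⟨b, htb, hba⟩ := exists_between ht.2
      exact mem_iUnion.2 ⟨⟨b, hba⟩, t, ⟨ht.1, htb⟩, rfl⟩)
    (Monotone.directed_le fun b c hbc => image_mono (Ico_subset_Ico_right hbc))
  rw [mem_Iio] at hb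
  rcases lt_or_ge b 0 with hb0 | hb0
  · rw [Ico_eq_empty (by simpa using hb0.le), image_empty] at hbu
    exact hbu (mem_univ (γ 0))
  · obtain ⟨t, ht, htb⟩ := hbu (mem_univ (γ b))
    exact ht.2.ne (h.inj ⟨ht.1, ht.2.trans hb⟩ ⟨hb0, hb⟩ htb)

/-- A compact connected Hausdorff space whose points have neighbourhoods homeomorphic to open
intervals or, for the points of a nonempty set `V`, to half-open intervals with that point as end
point, is an interval with end points `V`. -/
theorem isIntervalGraph_of_charts {Q : Type u} [TopologicalSpace Q] [T2Space Q] [CompactSpace Q]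
    [ConnectedSpace Q] {V : Set Q} (hV : V.Nonempty)
    (hend : ∀ q ∈ V, ∃ σ ρ, IsIntervalChart (Ico 0 1) σ ρ ∧ σ 0 = q)
    (hint : ∀ q ∉ V, ∃ σ ρ, IsIntervalChart (Ioo (-1) 1) σ ρ ∧ σ 0 = q) :
    IsIntervalGraph Q V := by
  classical
  have hcpt : ∃ δ > 0, ∀ ε : ℝ, 0 < ε → ε < δ → IsCompact (Ico 0 1 ∩ Icc (-ε) ε) := by
    refine ⟨1, one_pos, fun ε hε hε1 => ?_⟩
    convert isCompact_Icc (a := 0) (b := ε) using 1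
    ext s
    constructor
    · exact fun hs => ⟨hs.1.1, hs.2.2⟩
    · exact fun hs => ⟨⟨hs.1, hs.2.trans_lt hε1⟩, by linarith [hs.1], hs.2⟩
  -- End points are dropped from their charts, so that finitely many open interval charts cover
  -- everything outside `V` and only these are ever needed to extend an arc.
  have hcover : ∀ q, ∃ (l r : ℝ) (σ : ℝ → Q) (ρ : Q → ℝ), IsIntervalChart (Ioo l r) σ ρ ∧
      σ '' Ioo l r ∪ V ∈ 𝓝 q := by
    intro q
    by_cases hq : q ∈ V
    · obtain ⟨σ, ρ, hσ, rfl⟩ := hend q hq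
      have h1 := hσ.restrict isOpen_Ioi (W := Ioi 0)
      have h2 : Ico (0 : ℝ) 1 ∩ Ioi 0 = Ioo 0 1 := by
        ext s
        exact ⟨fun hs => ⟨hs.2, hs.1.2⟩, fun hs => ⟨⟨hs.1.le, hs.2⟩, hs.1⟩⟩
      rw [h2] at h1
      refine ⟨0, 1, σ, ρ, h1, mem_of_superset (hσ.isOpen.mem_nhds
        ⟨0, left_mem_Ico.2 one_pos, rfl⟩) ?_⟩
      rintro _ ⟨s, hs, rfl⟩
      rcases hs.1.eq_or_lt with rfl | hlt
      · exact Or.inr hq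
      · exact Or.inl ⟨s, ⟨hlt, hs.2⟩, rfl⟩
    · obtain ⟨σ, ρ, hσ, rfl⟩ := hint q hq
      exact ⟨-1, 1, σ, ρ, hσ, mem_of_superset (hσ.isOpen.mem_nhds ⟨0, by norm_num, rfl⟩)
        subset_union_left⟩
  choose l r σ ρ hσ hnhd using hcover
  obtain ⟨J, -, hJ⟩ := isCompact_univ.elim_nhds_subcover (fun q => σ q '' Ioo (l q) (r q) ∪ V)
    fun q _ => hnhd q
  -- Induction on the number of charts of the finite cover not yet contained in the arc. The arc is
  -- not closed, so it converges to a new point `q`. If `q ∈ V`, the completed arc is clopen and is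
  -- all of `Q`. Otherwise a chart of the cover around `q` is absorbed, and the count drops because
  -- `q` was not on the arc.
  have key : ∀ (n : ℕ) (a : ℝ) (γ : ℝ → Q), IsOpenArc a γ → γ 0 ∈ V →
      (J.filter fun j => ¬ σ j '' Ioo (l j) (r j) ⊆ γ '' Ico 0 a).card = n →
      IsIntervalGraph Q V := by
    intro n
    induction n using Nat.strong_induction_on with
    | _ n ih =>
    intro a γ hγ hγ0 hn
    obtain ⟨q, hqcl, hqn⟩ : ∃ q ∈ closure (γ '' Ico 0 a), q ∉ γ '' Ico 0 a := by
      by_contra! hcon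
      have hclopen : IsClopen (γ '' Ico 0 a) :=
        ⟨isClosed_of_closure_subset hcon, hγ.isOpen a le_rfl⟩
      exact hγ.image_ne_univ (hclopen.eq_univ ⟨_, 0, ⟨le_rfl, hγ.pos⟩, rfl⟩)
    by_cases hqV : q ∈ V
    · obtain ⟨σ', ρ', hσ', rfl⟩ := hend q hqV
      obtain ⟨γ', hγ', hγ'a, heq⟩ := hγ.exists_isClosedArc
        (tendsto_of_mem_closure_image_Ico hγ.cont hγ.inj hσ' (left_mem_Ico.2 one_pos) hcpt
          hqcl hqn) hqn
      have hγ'0 : γ' 0 ∈ V := heq ⟨le_rfl, hγ.pos⟩ ▸ hγ0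
      have hu : γ' '' Icc 0 a = univ :=
        IsClopen.eq_univ ⟨hγ'.isClosed_image le_rfl, hγ'.isOpen_image_Icc hσ' hγ'a.symm⟩
          ⟨_, 0, ⟨le_rfl, hγ.pos.le⟩, rfl⟩
      obtain ⟨e, he⟩ := hγ'.exists_homeomorph hu
      refine ⟨e, ?_⟩
      rw [Homeomorph.image_eq_preimage_symm]
      ext t
      rw [mem_preimage, he]
      constructor
      · intro ht
        by_contra hcon
        simp only [mem_insert_iff, mem_singleton_iff, not_or] at hcon
        obtain ⟨σ₁, ρ₁, hσ₁, hq₁⟩ := hend _ ht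
        refine hγ'.ne_of_mem_Ioo hσ₁ (t := a * t) ⟨?_, ?_⟩ hq₁.symm
        · exact mul_pos hγ.pos (unitInterval.pos_iff_ne_zero.2 hcon.1)
        · exact mul_lt_of_lt_one_right hγ.pos (unitInterval.lt_one_iff_ne_one.2 hcon.2)
      · rintro (rfl | rfl)
        · simpa using hγ'0
        · simpa [hγ'a] using hqV
    · obtain ⟨j, hj, hqj⟩ := mem_iUnion₂.1 (hJ (mem_univ q))
      obtain ⟨s₀, hs₀, hs₀q⟩ := hqj.resolve_right hqV
      -- The chart is recentred so that the limit point has coordinate `0`.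
      have hσ' := (hσ j).translate s₀
      have hpre : (fun s => s + s₀) ⁻¹' Ioo (l j) (r j) = Ioo (-(s₀ - l j)) (r j - s₀) := by
        rw [preimage_add_const_Ioo, neg_sub]
      have him : (fun s => σ j (s + s₀)) '' Ioo (-(s₀ - l j)) (r j - s₀) =
          σ j '' Ioo (l j) (r j) := by
        rw [← hpre, ← Function.comp_def (σ j) (fun s => s + s₀), image_comp,
          image_preimage_eq _ (add_right_surjective s₀)]
      rw [hpre] at hσ'
      have hc : 0 < s₀ - l j := by linarith [hs₀.1]
      have hd : 0 < r j - s₀ := by linarith [hs₀.2]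
      have hq0 : σ j (0 + s₀) = q := by rw [zero_add, hs₀q]
      have hcpt' : ∃ δ > 0, ∀ ε : ℝ, 0 < ε → ε < δ →
          IsCompact (Ioo (-(s₀ - l j)) (r j - s₀) ∩ Icc (-ε) ε) := by
        refine ⟨min (s₀ - l j) (r j - s₀), lt_min hc hd, fun ε hε hε1 => ?_⟩
        rw [inter_eq_right.2]
        · exact isCompact_Icc
        · intro s hs
          exact ⟨by linarith [hs.1, min_le_left (s₀ - l j) (r j - s₀)],
            by linarith [hs.2, min_le_right (s₀ - l j) (r j - s₀)]⟩
      obtain ⟨γ', hγ', hγ'a, heq⟩ := hγ.exists_isClosedArc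
        (tendsto_of_mem_closure_image_Ico hγ.cont hγ.inj hσ' ⟨by linarith, hd⟩ hcpt'
          (by rwa [hq0]) (by rwa [hq0])) (by rwa [hq0])
      obtain ⟨a', γ'', hγ'', h0, hsub⟩ := hγ'.exists_extension hc hd hσ' hγ'a.symm
      rw [him, heq.image_eq] at hsub
      refine ih _ ?_ a' γ'' hγ'' (by rw [h0, heq ⟨le_rfl, hγ.pos⟩]; exact hγ0) rfl
      rw [← hn]
      refine Finset.card_lt_card (Finset.ssubset_iff_of_subset ?_ |>.2 ⟨j, ?_, ?_⟩)
      · intro i hi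
        rw [Finset.mem_filter] at hi ⊢
        exact ⟨hi.1, fun hcon => hi.2 (hcon.trans (subset_union_left.trans hsub))⟩
      · rw [Finset.mem_filter]
        exact ⟨hj, fun hcon => hqn (hcon ⟨s₀, hs₀, hs₀q⟩)⟩
      · rw [Finset.mem_filter]
        exact fun hcon => hcon.2 (subset_union_right.trans hsub)
  obtain ⟨q, hq⟩ := hV
  obtain ⟨σ', ρ', hσ', rfl⟩ := hend q hq
  refine key _ 1 σ' ⟨one_pos, hσ'.cont, hσ'.injOn, fun b hb => ?_⟩ hq rfl
  convert hσ'.isOpen_image (isOpen_Iio (a := b)) using 2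
  ext s
  exact ⟨fun hs => ⟨⟨hs.1, hs.2.trans_le hb⟩, hs.2⟩, fun hs => ⟨hs.1.1, hs.2⟩⟩

end Arcs

/-! ### Open cones -/

namespace OpenCone

section Lift

variable {L : Type u} {Y : Type*}

theorem mk_of_eq_zero (v : L) {s : Ico (0 : ℝ) 1} (hs : (s : ℝ) = 0) : mk v s = vertex L :=
  Quotient.sound (Or.inr ⟨hs, trivial⟩)

theorem eq_vertex_or_mk (c : OpenCone L) :
    c = vertex L ∨ ∃ v, ∃ s : Ico (0 : ℝ) 1, 0 < (s : ℝ) ∧ c = mk v s := by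
  induction c using Quotient.inductionOn with
  | h a =>
    rcases a with ⟨v, s⟩ | _
    · rcases s.2.1.eq_or_lt with h | h
      · exact Or.inl (mk_of_eq_zero v h.symm)
      · exact Or.inr ⟨v, s, h, rfl⟩
    · exact Or.inl rfl

theorem mk_eq_mk {v w : L} {s t : Ico (0 : ℝ) 1} (hs : 0 < (s : ℝ)) (h : mk v s = mk w t) :
    v = w ∧ s = t := by
  rcases Quotient.exact h with h | ⟨h, -⟩
  · simpa using h
  · exact absurd h hs.ne'

/-- A function on the open cone, from a function on the product that is constant at height `0`. -/
def lift (f : L → Ico (0 : ℝ) 1 → Y) (y₀ : Y) (h : ∀ v (s : Ico (0 : ℝ) 1), (s : ℝ) = 0 → f v s = y₀) :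
    OpenCone L → Y :=
  Quotient.lift (Sum.elim (fun p => f p.1 p.2) fun _ => y₀) (by
    have key : ∀ a, ConeVertexPt a →
        Sum.elim (fun p : L × Ico (0 : ℝ) 1 => f p.1 p.2) (fun _ : Unit => y₀) a = y₀ := by
      rintro (⟨v, s⟩ | _) ha
      · exact h v s ha
      · rfl
    rintro a b (rfl | ⟨ha, hb⟩)
    · rfl
    · rw [key a ha, key b hb])

theorem map_mk (f : L → L) (v : L) (s : Ico (0 : ℝ) 1) : map f (mk v s) = mk (f v) s := rfl

theorem map_vertex (f : L → L) : map f (vertex L) = vertex L := rfl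

variable [TopologicalSpace L] [TopologicalSpace Y]

theorem continuous_lift {f : L → Ico (0 : ℝ) 1 → Y} {y₀ : Y}
    (h : ∀ v (s : Ico (0 : ℝ) 1), (s : ℝ) = 0 → f v s = y₀)
    (hf : Continuous fun p : L × Ico (0 : ℝ) 1 => f p.1 p.2) : Continuous (lift f y₀ h) :=
  Continuous.quotient_lift (hf.sumElim continuous_const) _

theorem continuous_mk : Continuous fun p : L × Ico (0 : ℝ) 1 => mk p.1 p.2 :=
  continuous_quotient_mk'.comp continuous_inl

/-- The height `s` of the point `[v, s]`. -/
def height : OpenCone L → ℝ := lift (fun _ s => s) 0 fun _ _ h => h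

omit [TopologicalSpace L] in
theorem height_mk (v : L) (s : Ico (0 : ℝ) 1) : height (mk v s) = s := rfl

omit [TopologicalSpace L] in
theorem height_vertex : height (vertex L) = 0 := rfl

theorem continuous_height : Continuous (height (L := L)) :=
  continuous_lift _ (continuous_subtype_val.comp continuous_snd)

omit [TopologicalSpace L] in
theorem height_map (f : L → L) (c : OpenCone L) : height (map f c) = height c := by
  rcases eq_vertex_or_mk c with rfl | ⟨v, s, -, rfl⟩ <;> rfl

omit [TopologicalSpace L] in
theorem height_nonneg (c : OpenCone L) : 0 ≤ height c := by
  rcases eq_vertex_or_mk c with rfl | ⟨v, s, hs, rfl⟩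
  · exact le_rfl
  · exact hs.le

/-- The neighbourhoods of the vertex of a cone on a compact space are given by the height. -/
theorem eventually_nhds_vertex [CompactSpace L] {W : Set (OpenCone L)} (hW : W ∈ 𝓝 (vertex L)) :
    ∀ᶠ s in 𝓝 (⟨0, by norm_num⟩ : Ico (0 : ℝ) 1), ∀ v : L, mk v s ∈ W := by
  -- The tube lemma along the compact slice at height `0`.
  have := isCompact_univ.eventually_forall_of_forall_eventually (X := Ico (0 : ℝ) 1) (Y := L)
    (x₀ := ⟨0, by norm_num⟩) (K := univ) (P := fun s v => mk v s ∈ W) fun v _ => by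
      refine (continuous_mk.comp continuous_swap).continuousAt.preimage_mem_nhds ?_
      simpa [mk_of_eq_zero] using hW
  simpa using this

end Lift

/-- The retraction of the real line onto `[0, 1/2]`, as a map to `[0, 1)`. -/
noncomputable def clamp (z : ℝ) : Ico (0 : ℝ) 1 :=
  ⟨max 0 (min z (1 / 2)), le_max_left _ _,
    max_lt one_pos ((min_le_right _ _).trans_lt (by norm_num))⟩

theorem continuous_clamp : Continuous clamp := by
  unfold clamp
  fun_prop

theorem coe_clamp {z : ℝ} (h0 : 0 ≤ z) (h1 : z ≤ 1 / 2) : (clamp z : ℝ) = z := by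
  simp only [clamp]
  rw [min_eq_left h1, max_eq_right h0]

theorem clamp_zero : (clamp 0 : ℝ) = 0 := coe_clamp le_rfl (by norm_num)

/-! ### Cones with several sheets -/

section Sheets

variable {L : Type u} [TopologicalSpace L]

/-- The path which for `|z| ≤ 1/2` has height `|z|`, and runs along `v` for `z ≥ 0` and along `w`
for `z ≤ 0`. -/
noncomputable def twoRays (v w : L) (z : ℝ) : OpenCone L :=
  if 0 ≤ z then mk v (clamp z) else mk w (clamp (-z))

omit [TopologicalSpace L] in
theorem twoRays_zero (v w : L) : twoRays v w 0 = vertex L := by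
  rw [twoRays, if_pos le_rfl, mk_of_eq_zero _ clamp_zero]

theorem continuous_twoRays (v w : L) : Continuous (twoRays v w) := by
  refine Continuous.if_le ?_ ?_ continuous_const continuous_id ?_
  · exact continuous_mk.comp (continuous_const.prodMk continuous_clamp)
  · exact continuous_mk.comp (continuous_const.prodMk (continuous_clamp.comp continuous_neg))
  · rintro z rfl
    rw [mk_of_eq_zero _ clamp_zero, mk_of_eq_zero]
    simpa using clamp_zero

/-- The height of a point of the cone, counted negatively off the sheet `A` of `L`. -/
noncomputable def signedHeight (A : Set L) : OpenCone L → ℝ := by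
  classical
  exact lift (fun v s => if v ∈ A then (s : ℝ) else -s) 0 (by
    intro v s hs
    split_ifs <;> simp [hs])

open Classical in
omit [TopologicalSpace L] in
theorem signedHeight_mk (A : Set L) (v : L) (s : Ico (0 : ℝ) 1) :
    signedHeight A (mk v s) = if v ∈ A then (s : ℝ) else -s := rfl

theorem continuous_signedHeight {A : Set L} (hA : IsClopen A) :
    Continuous (signedHeight A) := by
  classical
  refine continuous_lift _ ?_
  have hc : Continuous fun p : L × Ico (0 : ℝ) 1 => (p.2 : ℝ) := by fun_prop
  refine Continuous.if (fun p hp => ?_) hc hc.neg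
  have : frontier {p : L × Ico (0 : ℝ) 1 | p.1 ∈ A} = ∅ := (hA.preimage continuous_fst).frontier_eq
  rw [this] at hp
  exact hp.elim

omit [TopologicalSpace L] in
theorem eq_vertex_of_signedHeight_eq_zero {A : Set L} {c : OpenCone L}
    (h : signedHeight A c = 0) : c = vertex L := by
  classical
  rcases eq_vertex_or_mk c with rfl | ⟨v, s, hs, rfl⟩
  · rfl
  · rw [signedHeight_mk] at h
    split_ifs at h <;> linarith

omit [TopologicalSpace L] in
theorem signedHeight_map {A : Set L} {f : L → L} (hf : ∀ v, f v ∈ A ↔ v ∈ A) (c : OpenCone L) :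
    signedHeight A (map f c) = signedHeight A c := by
  classical
  rcases eq_vertex_or_mk c with rfl | ⟨v, s, -, rfl⟩
  · rfl
  · rw [map_mk, signedHeight_mk, signedHeight_mk]
    simp only [hf]

omit [TopologicalSpace L] in
theorem signedHeight_twoRays {A : Set L} {v w : L} (hv : v ∈ A) (hw : w ∉ A) {z : ℝ}
    (hz : |z| ≤ 1 / 2) : signedHeight A (twoRays v w z) = z := by
  classical
  rw [abs_le] at hz
  rw [twoRays]
  split_ifs with h
  · rw [signedHeight_mk, if_pos hv, coe_clamp h hz.2]
  · rw [signedHeight_mk, if_neg hw, coe_clamp (by linarith) (by linarith), neg_neg]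

/-- The signed height folds `A` and its complement onto the two half-lines, with the two rays along
`v` and `w` as section; only the vertex has height `0`. -/
theorem hasLocalRetraction_real {A : Set L} (hA : IsClopen A) {v w : L} (hv : v ∈ A) (hw : w ∉ A)
    {Z : Type*} [TopologicalSpace Z] [Subsingleton Z] (z₀ : Z) :
    HasLocalRetraction ℝ ((z₀, vertex L) : Z × OpenCone L) := by
  refine ⟨univ, univ_mem, fun y => signedHeight A y.2,
    ((continuous_signedHeight hA).comp continuous_snd).continuousOn, fun y _ hy => ?_,
    fun z => (z₀, twoRays v w z), by simp [twoRays_zero], Metric.ball 0 (1 / 2),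
    Metric.ball_mem_nhds _ (by norm_num),
    (continuous_const.prodMk (continuous_twoRays v w)).continuousOn, fun z hz => ⟨trivial, ?_⟩⟩
  · exact Prod.ext (Subsingleton.elim _ _) (eq_vertex_of_signedHeight_eq_zero hy)
  · exact signedHeight_twoRays hv hw (by simpa using (mem_ball_zero_iff.1 hz).le)

/-- The real part is the angle along the circle relative to `z₀`, the imaginary part the signed
height. Restricting to the slit plane makes the angle continuous, and on the disc of radius `1/2 <
π` it is recovered exactly from the section. -/
theorem hasLocalRetraction_complex {A : Set L} (hA : IsClopen A) {v w : L} (hv : v ∈ A)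
    (hw : w ∉ A) (z₀ : Torus 1) :
    HasLocalRetraction ℂ ((z₀, vertex L) : Torus 1 × OpenCone L) := by
  let q : Torus 1 × OpenCone L → ℂ := fun y => ((y.1 0 / z₀ 0 : Circle) : ℂ)
  have hq : Continuous q := by fun_prop
  refine ⟨q ⁻¹' Complex.slitPlane, hq.continuousAt.preimage_mem_nhds
      (Complex.isOpen_slitPlane.mem_nhds (by simp [q])),
    fun y => ⟨(q y).arg, signedHeight A y.2⟩, ?_, fun y hy h => ?_,
    fun z => (fun i => z₀ i * Circle.exp z.re, twoRays v w z.im), by simp [twoRays_zero],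
    Metric.ball 0 (1 / 2), Metric.ball_mem_nhds _ (by norm_num), Continuous.continuousOn ?_,
    fun z hz => ?_⟩
  · have h1 : ContinuousOn (fun y => (q y).arg) (q ⁻¹' Complex.slitPlane) := fun y hy =>
      ((Complex.continuousAt_arg hy).comp hq.continuousAt).continuousWithinAt
    have h2 : Continuous fun y : Torus 1 × OpenCone L => signedHeight A y.2 :=
      (continuous_signedHeight hA).comp continuous_snd
    exact Complex.equivRealProdCLM.symm.continuous.comp_continuousOn (h1.prodMk h2.continuousOn)
  · obtain ⟨h1, h2⟩ := Complex.ext_iff.1 h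
    refine Prod.ext (funext fun i => ?_) (eq_vertex_of_signedHeight_eq_zero h2)
    have : y.1 0 / z₀ 0 = 1 := Circle.injective_arg
      (show (q y).arg = ((1 : Circle) : ℂ).arg by rw [Circle.coe_one, Complex.arg_one]; exact h1)
    rw [Subsingleton.elim i 0]
    exact div_eq_one.1 this
  · exact (by fun_prop : Continuous fun z : ℂ => fun i => z₀ i * Circle.exp z.re).prodMk
      ((continuous_twoRays v w).comp Complex.continuous_im)
  · have hz' : ‖z‖ < 1 / 2 := mem_ball_zero_iff.1 hz
    have hre := abs_le.1 ((Complex.abs_re_le_norm z).trans hz'.le)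
    have hpi := Real.pi_gt_three
    have hqz : q (fun i => z₀ i * Circle.exp z.re, twoRays v w z.im) = Circle.exp z.re := by
      simp [q]
    have harg : (Circle.exp z.re : ℂ).arg = z.re :=
      Circle.arg_exp (by linarith) (by linarith)
    refine ⟨?_, Complex.ext ?_ ?_⟩
    · rw [mem_preimage, hqz, Complex.mem_slitPlane_iff_arg, harg]
      exact ⟨by linarith, Circle.coe_ne_zero _⟩
    · simp only [hqz, harg]
    · exact signedHeight_twoRays hv hw ((Complex.abs_im_le_norm z).trans hz'.le)

end Sheets

/-! ### The cone on one circle -/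

section Disc

variable {L : Type u} [TopologicalSpace L]

/-- The open cone on the circle is the open unit disc. -/
theorem exists_openPartialHomeomorph_complex (ε : L ≃ₜ Circle) :
    ∃ φ : OpenPartialHomeomorph (OpenCone L) ℂ, φ.source = univ := by
  classical
  have : CompactSpace L := ε.symm.compactSpace
  let F : OpenCone L → ℂ := lift (fun v s => (s : ℝ) * (ε v : ℂ)) 0 (by
    intro v s hs
    simp [hs])
  have hF : Continuous F := continuous_lift _ (by fun_prop)
  have hFmk : ∀ v s, F (mk v s) = (s : ℝ) * (ε v : ℂ) := fun _ _ => rfl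
  let dir : ℂ → Circle := fun z => Circle.exp z.arg
  let G : ℂ → OpenCone L := fun z => if h : z ∈ Metric.ball (0 : ℂ) 1 then
    mk (ε.symm (dir z)) ⟨‖z‖, norm_nonneg z, by simpa using h⟩ else vertex L
  have hG : ∀ z (h : ‖z‖ < 1), G z = mk (ε.symm (dir z)) ⟨‖z‖, norm_nonneg z, h⟩ := fun z h =>
    dif_pos (by simpa using h)
  refine ⟨{
    toFun := F
    invFun := G
    source := univ
    target := Metric.ball 0 1
    map_source' := ?_
    map_target' := fun _ _ => trivial
    left_inv' := ?_
    right_inv' := ?_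
    open_source := isOpen_univ
    open_target := Metric.isOpen_ball
    continuousOn_toFun := hF.continuousOn
    continuousOn_invFun := ?_ }, rfl⟩
  · intro c _
    rcases eq_vertex_or_mk c with rfl | ⟨v, s, hs, rfl⟩
    · exact Metric.mem_ball_self one_pos
    · rw [hFmk, mem_ball_zero_iff, norm_mul, Circle.norm_coe, mul_one, Complex.norm_real,
        Real.norm_eq_abs, abs_of_pos hs]
      exact s.2.2
  · intro c _
    rcases eq_vertex_or_mk c with rfl | ⟨v, s, hs, rfl⟩
    · have : F (vertex L) = 0 := rfl
      rw [this, hG 0 (by simp), mk_of_eq_zero _ norm_zero]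
    · have hn : ‖F (mk v s)‖ = s := by
        rw [hFmk, norm_mul, Circle.norm_coe, mul_one, Complex.norm_real, Real.norm_eq_abs,
          abs_of_pos hs]
      have hd : dir (F (mk v s)) = ε v := by
        simp only [dir]
        rw [hFmk, Complex.arg_real_mul _ hs, Circle.exp_arg]
      rw [hG _ (hn ▸ s.2.2)]
      congr 1
      · rw [hd, ε.symm_apply_apply]
      · exact Subtype.ext hn
  · intro z hz
    rw [hG z (by simpa using hz), hFmk, ε.apply_symm_apply]
    simp only [dir, Circle.coe_exp]
    exact Complex.norm_mul_exp_arg_mul_I z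
  · intro z hz
    apply ContinuousAt.continuousWithinAt
    -- The direction has no limit at the origin, where continuity rests on neighbourhoods of the
    -- vertex being controlled by height alone. Elsewhere the direction is `z / ‖z‖`.
    by_cases h0 : z = 0
    · subst h0
      have hG0 : G 0 = vertex L := by rw [hG 0 (by simp), mk_of_eq_zero _ norm_zero]
      rw [ContinuousAt, hG0]
      intro W hW
      have h1 := eventually_nhds_vertex hW
      rw [nhds_subtype_eq_comap, eventually_comap] at h1
      have h2 : Tendsto (fun z : ℂ => ‖z‖) (𝓝 0) (𝓝 0) := by
        simpa using (continuous_norm (E := ℂ)).tendsto 0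
      rw [mem_map]
      filter_upwards [h2.eventually h1, Metric.ball_mem_nhds (0 : ℂ) one_pos] with z hz hz1
      rw [mem_preimage, hG z (by simpa using hz1)]
      exact hz _ rfl _
    · have hb : Metric.ball (0 : ℂ) 1 \ {0} ∈ 𝓝 z :=
        (Metric.isOpen_ball.sdiff isClosed_singleton).mem_nhds ⟨hz, h0⟩
      refine ContinuousOn.continuousAt ?_ hb
      have hdir : ContinuousOn dir {0}ᶜ := by
        have : ContinuousOn (fun z : ℂ => (dir z : ℂ)) {0}ᶜ := by
          have h3 : ContinuousOn (fun z : ℂ => z / ‖z‖) {0}ᶜ :=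
            continuousOn_id.div (by fun_prop) (by simp)
          refine h3.congr fun z hz => ?_
          have hz0 : (‖z‖ : ℂ) ≠ 0 := by simpa using hz
          rw [eq_div_iff hz0, mul_comm]
          simp only [dir, Circle.coe_exp]
          exact Complex.norm_mul_exp_arg_mul_I z
        exact Topology.IsInducing.subtypeVal.continuousOn_iff.2 this
      rw [continuousOn_iff_continuous_domRestrict] at hdir ⊢
      have h4 : Continuous fun w : (Metric.ball (0 : ℂ) 1 \ {0} : Set ℂ) =>
          mk (ε.symm (dir w)) (⟨‖(w : ℂ)‖, norm_nonneg _, by simpa using w.2.1⟩ : Ico (0 : ℝ) 1) := by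
        refine continuous_mk.comp (Continuous.prodMk (ε.symm.continuous.comp ?_) ?_)
        · exact hdir.comp (f := fun w : (Metric.ball (0 : ℂ) 1 \ {0} : Set ℂ) =>
            (⟨w, w.2.2⟩ : ({0}ᶜ : Set ℂ))) (by fun_prop)
        · fun_prop
      convert h4 using 1
      ext w
      exact hG w (by simpa using w.2.1)

end Disc

end OpenCone

/-! ### Charts of locally standard spaces -/

/-- The homeomorphism of an open subset `U` with `Y`, as a partial homeomorphism. -/
noncomputable def Homeomorph.openPartialHomeomorphOfIsOpen {X Y : Type*} [TopologicalSpace X]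
    [TopologicalSpace Y] {U : Set X} (φ : U ≃ₜ Y) (hU : IsOpen U) (hne : U.Nonempty) :
    OpenPartialHomeomorph X Y :=
  have : Nonempty U := hne.to_subtype
  (hU.isOpenEmbedding_subtypeVal.toOpenPartialHomeomorph _).symm.transHomeomorph φ

theorem Homeomorph.openPartialHomeomorphOfIsOpen_source {X Y : Type*} [TopologicalSpace X]
    [TopologicalSpace Y] {U : Set X} (φ : U ≃ₜ Y) (hU : IsOpen U) (hne : U.Nonempty) :
    (φ.openPartialHomeomorphOfIsOpen hU hne).source = U := by
  simp [openPartialHomeomorphOfIsOpen]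

theorem Homeomorph.openPartialHomeomorphOfIsOpen_target {X Y : Type*} [TopologicalSpace X]
    [TopologicalSpace Y] {U : Set X} (φ : U ≃ₜ Y) (hU : IsOpen U) (hne : U.Nonempty) :
    (φ.openPartialHomeomorphOfIsOpen hU hne).target = univ := by
  simp [openPartialHomeomorphOfIsOpen]

theorem Homeomorph.openPartialHomeomorphOfIsOpen_apply {X Y : Type*} [TopologicalSpace X]
    [TopologicalSpace Y] {U : Set X} (φ : U ≃ₜ Y) (hU : IsOpen U) (hne : U.Nonempty) (x : U) :
    φ.openPartialHomeomorphOfIsOpen hU hne x = φ x := by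
  have : Nonempty U := hne.to_subtype
  have h : (hU.isOpenEmbedding_subtypeVal.toOpenPartialHomeomorph
      ((↑) : U → X)).symm (x : X) = x :=
    OpenPartialHomeomorph.left_inv _ (x := x) (by simp)
  simp only [openPartialHomeomorphOfIsOpen, OpenPartialHomeomorph.transHomeomorph_apply,
    Function.comp]
  rw [h]

/-- A chart at a point with an orbit of codimension one: an invariant neighbourhood is
homeomorphic to `T^k × c(L)`, where the link `L` consists of `r` circles. -/
structure VertexChart (m k : ℕ) {X : Type u} [TopologicalSpace X] [MulAction (Torus m) X]
    (x : X) where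
  L : Type u
  [topologicalSpace : TopologicalSpace L]
  [mulAction : MulAction (Torus 1) L]
  r : ℕ
  e : L ≃ₜ Fin r × Torus 1
  e_smul : ∀ (t : Torus 1) (v : L), e (t • v) = ((e v).1, t * (e v).2)
  chart : OpenPartialHomeomorph X (Torus k × OpenCone L)
  mem_source : x ∈ chart.source
  target_eq : chart.target = univ
  smul_mem : ∀ (t : Torus m), ∀ y ∈ chart.source, t • y ∈ chart.source
  α : Torus m ≃* Torus k × Torus 1
  mem_stabilizer : ∀ t : Torus m, t ∈ MulAction.stabilizer (Torus m) x ↔ (α t).1 = 1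
  chart_smul : ∀ (t : Torus m), ∀ y ∈ chart.source, chart (t • y) =
    ((α t).1 * (chart y).1, OpenCone.map (fun v => (α t).2 • v) (chart y).2)

attribute [instance] VertexChart.topologicalSpace VertexChart.mulAction

/-- A chart at a point with a free orbit: an invariant neighbourhood is homeomorphic to
`Ω × T^k`, where `Ω` is an annulus. -/
structure FreeChart (m k : ℕ) {X : Type u} [TopologicalSpace X] [MulAction (Torus m) X]
    (x : X) where
  chart : OpenPartialHomeomorph X ((Fin 1 → ℂ) × Torus k)
  mem_source : x ∈ chart.source
  Ω : Set (Fin 1 → ℂ)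
  target_eq : chart.target = Ω ×ˢ univ
  ne_zero : ∀ w ∈ Ω, w 0 ≠ 0
  smul_mem : ∀ (t : Torus m), ∀ y ∈ chart.source, t • y ∈ chart.source
  α : Torus m ≃* Torus 1 × Torus k
  chart_smul : ∀ (t : Torus m), ∀ y ∈ chart.source, chart (t • y) =
    (fun j => ((α t).1 j : ℂ) * (chart y).1 j, (α t).2 * (chart y).2)

/-! ### Specializing the local models to `l = 0`, `n = 1` -/

section Extract

variable {m : ℕ} {X : Type u} [TopologicalSpace X] [MulAction (Torus m) X]

theorem IsLocallyStandard.isFilteredTorusSpace {l n : ℕ} (h : IsLocallyStandard l m n X) :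
    IsFilteredTorusSpace l m n X := by
  rw [IsLocallyStandard] at h
  exact h.1

/-- For `i = 0` the factors `O` and `Ω` are points, and the dimension count forces a nonempty link
to have `l' = n' = 0`, the base case: a union of circles. An empty link is recorded as `r = 0`. -/
theorem IsLocallyStandard.nonempty_vertexChart (h : IsLocallyStandard 0 m 1 X) {x : X}
    (hx : OrbitHasDim m x (m - 1)) : Nonempty (VertexChart m (m - 1) x) := by
  rw [IsLocallyStandard] at h
  obtain ⟨U, hU, L, tL, aL, O, Ω, φ, α, hUo, hxU, hL, -, -, -, -, -, hst, heq⟩ :=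
    h.2.2 (by norm_num) 0 (by norm_num) x (by simpa using hx)
  have o : O := (φ ⟨x, hxU⟩).1
  have w : Ω := (φ ⟨x, hxU⟩).2.1.1
  let _ : Unique O := ⟨⟨o⟩, fun _ => Subsingleton.elim _ _⟩
  let _ : Unique Ω := ⟨⟨w⟩, fun _ => Subsingleton.elim _ _⟩
  obtain ⟨r, e, he⟩ : ∃ (r : ℕ) (e : L ≃ₜ Fin r × Torus 1),
      ∀ (t : Torus 1) (v : L), e (t • v) = ((e v).1, t * (e v).2) := by
    rcases hL with hL | ⟨l', n', hln, hL⟩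
    · have : IsEmpty (Fin 0 × Torus 1) := inferInstance
      exact ⟨0, Homeomorph.empty, fun t v => isEmptyElim v⟩
    · obtain rfl : l' = 0 := by omega
      obtain rfl : n' = 0 := by omega
      rw [IsLocallyStandard] at hL
      exact hL.2.1 rfl
  let φ' : U ≃ₜ Torus (m - 1) × OpenCone L :=
    φ.trans ((Homeomorph.uniqueProd _ _).trans
      ((Homeomorph.uniqueProd _ _).prodCongr (Homeomorph.refl _)))
  have hφ' : ∀ y, φ' y = ((φ y).2.1.2, (φ y).2.2) := fun y => rfl
  let ψ := φ'.openPartialHomeomorphOfIsOpen hUo ⟨x, hxU⟩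
  have hs : ψ.source = U := φ'.openPartialHomeomorphOfIsOpen_source hUo ⟨x, hxU⟩
  have hψ : ∀ y : U, ψ y = ((φ y).2.1.2, (φ y).2.2) := fun y =>
    (φ'.openPartialHomeomorphOfIsOpen_apply hUo ⟨x, hxU⟩ y).trans (hφ' y)
  let β : (Torus 0 × Torus (m - 1)) × Torus (1 - 0) ≃* Torus (m - 1) × Torus 1 :=
    { toFun := fun p => (p.1.2, p.2)
      invFun := fun p => ((1, p.1), p.2)
      left_inv := fun p => Prod.ext (Prod.ext (Subsingleton.elim _ _) rfl) rfl
      right_inv := fun p => rfl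
      map_mul' := fun p q => rfl }
  refine ⟨{
    L := L
    r := r
    e := e
    e_smul := he
    chart := ψ
    mem_source := hs ▸ hxU
    target_eq := φ'.openPartialHomeomorphOfIsOpen_target hUo ⟨x, hxU⟩
    smul_mem := hs ▸ hU
    α := α.toMulEquiv.trans β
    mem_stabilizer := fun t => ?_
    chart_smul := fun t y hy => ?_ }⟩
  · rw [hst t]
    constructor
    · intro h
      exact congrArg Prod.snd h
    · intro h
      exact Prod.ext (Subsingleton.elim _ _) h
  · rw [hs] at hy
    obtain ⟨-, -, h3, h4⟩ := heq t ⟨y, hy⟩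
    rw [hψ ⟨y, hy⟩, hψ ⟨t • y, hU t y hy⟩, h3, h4]
    rfl

/-- For `i = 1` the dimension count leaves no room for a nonempty link, so the cone factor is a
point. -/
theorem IsLocallyStandard.nonempty_freeChart (h : IsLocallyStandard 0 m 1 X) {x : X}
    (hx : OrbitHasDim m x (1 + (m - 1))) : Nonempty (FreeChart m (m - 1) x) := by
  rw [IsLocallyStandard] at h
  obtain ⟨U, hU, L, tL, aL, O, Ω, φ, α, hUo, hxU, hL, -, -, hΩ, hΩ0, -, -, heq⟩ :=
    h.2.2 (by norm_num) 1 (by norm_num) x hx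
  have o : O := (φ ⟨x, hxU⟩).1
  have hLe : IsEmpty L := hL.resolve_right (by rintro ⟨l', n', hln, -⟩; omega)
  let _ : Unique O := ⟨⟨o⟩, fun _ => Subsingleton.elim _ _⟩
  let _ : Unique (OpenCone L) := ⟨⟨OpenCone.vertex L⟩, fun c => by
    rcases OpenCone.eq_vertex_or_mk c with rfl | ⟨v, -⟩
    · rfl
    · exact isEmptyElim v⟩
  let φ' : U ≃ₜ Ω × Torus (m - 1) :=
    φ.trans ((Homeomorph.uniqueProd _ _).trans (Homeomorph.prodUnique _ _))
  have hφ' : ∀ y, φ' y = (φ y).2.1 := fun y => rfl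
  have hne : (Ω ×ˢ (univ : Set (Torus (m - 1)))).Nonempty :=
    ⟨((φ ⟨x, hxU⟩).2.1.1, (φ ⟨x, hxU⟩).2.1.2), Subtype.coe_prop _, trivial⟩
  have hneΩ : Nonempty Ω := ⟨(φ ⟨x, hxU⟩).2.1.1⟩
  let ψ := (φ'.openPartialHomeomorphOfIsOpen hUo ⟨x, hxU⟩).trans
    ((hΩ.isOpenEmbedding_subtypeVal.toOpenPartialHomeomorph _).prod
      (Homeomorph.refl (Torus (m - 1))).toOpenPartialHomeomorph)
  have hs : ψ.source = U := by
    simp [ψ, φ'.openPartialHomeomorphOfIsOpen_source hUo ⟨x, hxU⟩]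
  have hψ : ∀ y : U, ψ y = (((φ y).2.1.1 : Fin 1 → ℂ), (φ y).2.1.2) := by
    intro y
    have := φ'.openPartialHomeomorphOfIsOpen_apply hUo ⟨x, hxU⟩ y
    simp only [ψ, OpenPartialHomeomorph.coe_trans, Function.comp, this, hφ']
    rfl
  let β : (Torus 1 × Torus (m - 1)) × Torus (1 - 1) ≃* Torus 1 × Torus (m - 1) :=
    { toFun := fun p => p.1
      invFun := fun p => (p, 1)
      left_inv := fun p => Prod.ext rfl (Subsingleton.elim (α := Torus 0) _ _)
      right_inv := fun p => rfl
      map_mul' := fun p q => rfl }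
  refine ⟨{
    chart := ψ
    mem_source := hs ▸ hxU
    Ω := Ω
    target_eq := ?_
    ne_zero := fun w hw => hΩ0 w hw 0
    smul_mem := hs ▸ hU
    α := α.toMulEquiv.trans β
    chart_smul := fun t y hy => ?_ }⟩
  · simp [ψ, φ'.openPartialHomeomorphOfIsOpen_target hUo ⟨x, hxU⟩]
  · rw [hs] at hy
    obtain ⟨-, h2, h3, -⟩ := heq t ⟨y, hy⟩
    rw [hψ ⟨y, hy⟩, hψ ⟨t • y, hU t y hy⟩, h2, h3]
    rfl

end Extract

/-! ### Slices and orbit spaces -/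

section Quotient

variable {G X : Type*} [Group G] [MulAction G X] [TopologicalSpace X]

/-- A local slice of a group action that is parametrized by `I ⊆ ℝ` gives a chart of the orbit
space. -/
theorem exists_isIntervalChart_quotient [ContinuousConstSMul G X] {I : Set ℝ} {s : ℝ → X}
    (hs : ContinuousOn s I) {U : Set X} (hU : IsOpen U) {ρ : X → ℝ} (hρ : ContinuousOn ρ U)
    (hsU : ∀ i ∈ I, s i ∈ U ∧ ρ (s i) = i)
    (hinv : ∀ y ∈ U, ∀ t : G, t • y ∈ U → ρ (t • y) = ρ y)
    (horb : ∀ y ∈ U, ρ y ∈ I ∧ ∃ t : G, t • s (ρ y) = y) :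
    ∃ ρ', IsIntervalChart I
      (fun i => (Quotient.mk _ (s i) : MulAction.orbitRel.Quotient G X)) ρ' := by
  let π : X → MulAction.orbitRel.Quotient G X := Quotient.mk _
  have hπ : IsOpenMap π := isOpenMap_quotient_mk'_mul
  have hπeq : ∀ y ∈ U, π (s (ρ y)) = π y := fun y hy => by
    obtain ⟨t, ht⟩ := (horb y hy).2
    exact (Quotient.sound ⟨t, ht⟩ : π y = π (s (ρ y))).symm
  have hinj : InjOn (fun i => π (s i)) I := by
    intro i hi j hj hij
    obtain ⟨t, ht⟩ : ∃ t : G, t • s j = s i := Quotient.exact hij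
    rw [← (hsU i hi).2, ← (hsU j hj).2, ← ht]
    exact hinv _ (hsU j hj).1 t (ht ▸ (hsU i hi).1)
  let ρ' := Function.invFunOn (fun i => π (s i)) I
  have hρ' : ∀ i ∈ I, ρ' (π (s i)) = i := fun i hi => hinj.leftInvOn_invFunOn hi
  -- Preimages under the inverse chart are images under `π` of sets cut out upstairs by `ρ`; since
  -- `π` is open, continuity of `ρ` descends.
  have him : ∀ W : Set ℝ, ((fun i => π (s i)) '' I) ∩ ρ' ⁻¹' W = π '' (U ∩ ρ ⁻¹' W) := by
    intro W
    ext q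
    constructor
    · rintro ⟨⟨i, hi, rfl⟩, hW⟩
      refine ⟨s i, ⟨(hsU i hi).1, ?_⟩, rfl⟩
      rw [mem_preimage, (hsU i hi).2]
      simpa [hρ' i hi] using hW
    · rintro ⟨y, ⟨hy, hW⟩, rfl⟩
      rw [← hπeq y hy]
      refine ⟨⟨ρ y, (horb y hy).1, rfl⟩, ?_⟩
      rw [mem_preimage, hρ' _ (horb y hy).1]
      exact hW
  refine ⟨ρ', ?_, continuous_quotient_mk'.comp_continuousOn hs, ?_, hρ'⟩
  · have := him univ
    rw [preimage_univ, preimage_univ, inter_univ, inter_univ] at this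
    rw [this]
    exact hπ _ hU
  · have ho : IsOpen ((fun i => π (s i)) '' I) := by
      have := him univ
      rw [preimage_univ, preimage_univ, inter_univ, inter_univ] at this
      rw [this]
      exact hπ _ hU
    refine (continuousOn_open_iff ho).2 fun W hW => ?_
    rw [him W]
    exact hπ _ (hρ.isOpen_inter_preimage hU hW)

instance t2Space_orbitRel_quotient [TopologicalSpace G] [CompactSpace G] [CompactSpace X]
    [T2Space X] [ContinuousSMul G X] : T2Space (MulAction.orbitRel.Quotient G X) :=
  have : ProperSMul G X := ⟨Continuous.isProperMap (by fun_prop)⟩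
  t2Space_quotient_mulAction_of_properSMul

end Quotient

theorem exists_torus_chart (k : ℕ) (z : Torus k) :
    ∃ φ : OpenPartialHomeomorph (Torus k) (Fin k → EuclideanSpace ℝ (Fin 1)), z ∈ φ.source :=
  ⟨OpenPartialHomeomorph.pi fun i => chartAt (EuclideanSpace ℝ (Fin 1)) (z i),
    fun i _ => mem_chart_source _ (z i)⟩

/-! ### Local structure of `X` and of its orbit space -/

section Local

variable {m k : ℕ} {X : Type u} [TopologicalSpace X] [MulAction (Torus m) X] {x : X}

namespace VertexChart

variable (C : VertexChart m k x)

theorem symm_mem (p : Torus k × OpenCone C.L) : C.chart.symm p ∈ C.chart.source :=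
  C.chart.map_target (C.target_eq ▸ mem_univ p)

theorem apply_symm (p : Torus k × OpenCone C.L) : C.chart (C.chart.symm p) = p :=
  C.chart.right_inv (C.target_eq ▸ mem_univ p)

theorem continuous_symm : Continuous C.chart.symm :=
  continuousOn_univ.1 (C.target_eq ▸ C.chart.continuousOn_symm)

theorem eq_one_of_smul_eq {t : Torus 1} {v : C.L} (h : t • v = v) : t = 1 := by
  have := C.e_smul t v
  rw [h] at this
  simpa using (congrArg Prod.snd this).symm

theorem smul_eq_of_chart_snd_eq_vertex {y : X} (hy : y ∈ C.chart.source)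
    (hv : (C.chart y).2 = OpenCone.vertex C.L) {t : Torus m} (ht : (C.α t).1 = 1) :
    t • y = y := by
  refine C.chart.injOn (C.smul_mem t y hy) hy ?_
  rw [C.chart_smul t y hy, ht, one_mul, hv, OpenCone.map_vertex, ← hv]

theorem exists_ne_one : ∃ t : Torus m, (C.α t).1 = 1 ∧ (C.α t).2 ≠ 1 := by
  -- The element `-1` of the circle acting on the link; any nontrivial element would do.
  refine ⟨C.α.symm (1, fun _ => Circle.exp Real.pi), by simp, fun h => ?_⟩
  rw [MulEquiv.apply_symm_apply] at h
  have := congrArg (fun z : Circle => (z : ℂ)) (congrFun h 0)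
  simp only [Circle.coe_exp, Complex.exp_pi_mul_I, Pi.one_apply, Circle.coe_one] at this
  norm_num at this

/-- The isotropy group of `x` contains elements acting nontrivially through the circle factor, and
these fix no point of the link. So `x` cannot have positive height. -/
theorem chart_snd : (C.chart x).2 = OpenCone.vertex C.L := by
  rcases OpenCone.eq_vertex_or_mk (C.chart x).2 with h | ⟨v, s, hs, h⟩
  · exact h
  · obtain ⟨t, ht1, ht2⟩ := C.exists_ne_one
    have hx : t • x = x := (C.mem_stabilizer t).2 ht1
    have h1 := congrArg Prod.snd (C.chart_smul t x C.mem_source)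
    rw [hx] at h1
    simp only [h, OpenCone.map_mk] at h1
    exact absurd (C.eq_one_of_smul_eq (OpenCone.mk_eq_mk hs h1).1.symm) ht2

/-- The link is not empty, since there are free orbits. -/
theorem nonempty_link [ConnectedSpace X] [T2Space X] {x₀ : X}
    (hx₀ : MulAction.stabilizer (Torus m) x₀ = ⊥) : Nonempty C.L := by
  by_contra hL
  rw [not_nonempty_iff] at hL
  have hv : ∀ c : OpenCone C.L, c = OpenCone.vertex C.L := fun c => by
    rcases OpenCone.eq_vertex_or_mk c with rfl | ⟨v, -⟩
    · rfl
    · exact isEmptyElim v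
  -- With an empty link the chart domain is the image of a compact torus, hence clopen and all of
  -- `X`. Then every point would have nontrivial isotropy, contradicting the free orbit.
  have him : C.chart.source = range fun z : Torus k => C.chart.symm (z, OpenCone.vertex C.L) := by
    ext y
    constructor
    · intro hy
      refine ⟨(C.chart y).1, ?_⟩
      simp only
      rw [← hv (C.chart y).2, Prod.mk.eta, C.chart.left_inv hy]
    · rintro ⟨z, rfl⟩
      exact C.symm_mem _
  have hclosed : IsClosed C.chart.source := by
    rw [him]
    exact (isCompact_range (C.continuous_symm.comp (by fun_prop))).isClosed
  have hu : C.chart.source = univ :=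
    IsClopen.eq_univ ⟨hclosed, C.chart.open_source⟩ ⟨x, C.mem_source⟩
  obtain ⟨t, ht1, ht2⟩ := C.exists_ne_one
  have ht : t ∈ MulAction.stabilizer (Torus m) x₀ :=
    C.smul_eq_of_chart_snd_eq_vertex (hu ▸ mem_univ x₀) (hv _) ht1
  rw [hx₀, Subgroup.mem_bot] at ht
  rw [ht, map_one] at ht2
  exact ht2 rfl

/-- The part of the link in the same sheet as `v`. -/
def sheet (v : C.L) : Set C.L := {w | (C.e w).1 = (C.e v).1}

theorem isClopen_sheet (v : C.L) : IsClopen (C.sheet v) :=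
  (isClopen_discrete {(C.e v).1}).preimage (continuous_fst.comp C.e.continuous)

theorem smul_mem_sheet (v w : C.L) (t : Torus 1) : t • w ∈ C.sheet v ↔ w ∈ C.sheet v := by
  simp only [sheet, mem_ofPred_eq, C.e_smul]

theorem exists_smul_eq {v w : C.L} (h : w ∈ C.sheet v) : ∃ t : Torus 1, t • v = w := by
  refine ⟨(C.e w).2 / (C.e v).2, C.e.injective ?_⟩
  rw [C.e_smul, div_mul_cancel]
  exact Prod.ext h.symm rfl

theorem hasLocalRetraction_real [Subsingleton (Torus k)] {v w : C.L} (h : w ∉ C.sheet v) :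
    HasLocalRetraction ℝ (C.chart x) := by
  have := OpenCone.hasLocalRetraction_real (C.isClopen_sheet v) (v := v) rfl h (C.chart x).1
  rwa [← C.chart_snd] at this

theorem hasLocalRetraction_complex {x : X} (C : VertexChart m 1 x) {v w : C.L}
    (h : w ∉ C.sheet v) : HasLocalRetraction ℂ (C.chart x) := by
  have := OpenCone.hasLocalRetraction_complex (C.isClopen_sheet v) (v := v) rfl h (C.chart x).1
  rwa [← C.chart_snd] at this

theorem mem_sheet_of_puncturedConnected [Subsingleton (Torus k)] (hx : PuncturedConnected x)
    (v w : C.L) : w ∈ C.sheet v := by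
  by_contra h
  refine (C.hasLocalRetraction_real h).not_puncturedConnected
    (.of_chart C.chart.symm (C.chart.map_source C.mem_source) ?_)
  rwa [C.chart.left_inv C.mem_source]

theorem mem_sheet_of_puncturedLog {x : X} (C : VertexChart m 1 x) (hx : PuncturedLog x)
    (v w : C.L) : w ∈ C.sheet v := by
  by_contra h
  refine (C.hasLocalRetraction_complex h).not_puncturedLog
    (.of_chart C.chart.symm (C.chart.map_source C.mem_source) ?_)
  rwa [C.chart.left_inv C.mem_source]

/-- A single sheet means that the link is one circle, so its cone is a disc and the chart is
modelled on `T^k` times a disc. -/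
theorem isLocallyEuclideanAt [Nonempty C.L] (h : ∀ v w : C.L, w ∈ C.sheet v) :
    IsLocallyEuclideanAt (k + 2) x := by
  obtain ⟨v₀⟩ := ‹Nonempty C.L›
  let _ : Unique (Fin C.r) := ⟨⟨(C.e v₀).1⟩, fun j => by
    have := h v₀ (C.e.symm (j, 1))
    simpa [sheet] using this⟩
  let ε : C.L ≃ₜ Circle := C.e.trans ((Homeomorph.uniqueProd _ _).trans
    (Homeomorph.funUnique (Fin 1) Circle))
  obtain ⟨φ, hφ⟩ := OpenCone.exists_openPartialHomeomorph_complex ε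
  obtain ⟨τ, hτ⟩ := exists_torus_chart k (C.chart x).1
  refine .of_chart (C.chart.trans (τ.prod φ)) ?_ (by simp [Module.finrank_pi_fintype])
  rw [OpenPartialHomeomorph.trans_source]
  exact ⟨C.mem_source, hτ, hφ ▸ mem_univ _⟩

/-- The ray over a fixed `v₀` is a slice: height is invariant, and with one sheet it determines the
orbit, because the torus acts transitively on `T^k` times the sheet. -/
theorem exists_isIntervalChart [ContinuousConstSMul (Torus m) X] [Nonempty C.L]
    (h : ∀ v w : C.L, w ∈ C.sheet v) :
    ∃ σ ρ, IsIntervalChart (Ico 0 1) σ ρ ∧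
      σ 0 = (Quotient.mk _ x : MulAction.orbitRel.Quotient (Torus m) X) := by
  obtain ⟨v₀⟩ := ‹Nonempty C.L›
  -- `clamp` is the identity only up to `1/2`, so heights in `[0, 1/2)` are rescaled to `[0, 1)`.
  let s : ℝ → X := fun i => C.chart.symm (1, OpenCone.mk v₀ (OpenCone.clamp (i / 2)))
  let ρ : X → ℝ := fun y => 2 * OpenCone.height (C.chart y).2
  let U : Set X := C.chart.source ∩ ρ ⁻¹' Iio 1
  have hs : Continuous s := C.continuous_symm.comp (continuous_const.prodMk
    (OpenCone.continuous_mk.comp (continuous_const.prodMk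
      (OpenCone.continuous_clamp.comp (by fun_prop)))))
  have hρ : ContinuousOn ρ C.chart.source := continuousOn_const.mul
    ((OpenCone.continuous_height.comp continuous_snd).comp_continuousOn C.chart.continuousOn)
  have hsi : ∀ i ∈ Ico (0 : ℝ) 1, s i ∈ U ∧ ρ (s i) = i := by
    intro i hi
    have : ρ (s i) = i := by
      simp only [ρ, s]
      rw [C.apply_symm, OpenCone.height_mk,
        OpenCone.coe_clamp (by linarith [hi.1]) (by linarith [hi.2])]
      ring
    exact ⟨⟨C.symm_mem _, by rw [mem_preimage, this]; exact hi.2⟩, this⟩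
  have horb : ∀ y ∈ C.chart.source, ∀ i : ℝ, ∀ v : C.L,
      (C.chart y).2 = OpenCone.mk v (OpenCone.clamp (i / 2)) → ∃ t : Torus m, t • s i = y := by
    intro y hy i v hv
    obtain ⟨τ, hτ⟩ := C.exists_smul_eq (h v₀ v)
    refine ⟨C.α.symm ((C.chart y).1, τ), C.chart.injOn (C.smul_mem _ _ (C.symm_mem _)) hy ?_⟩
    rw [C.chart_smul _ _ (C.symm_mem _), C.apply_symm, MulEquiv.apply_symm_apply, mul_one,
      OpenCone.map_mk, hτ, ← hv]
  have hvert : ∀ v : C.L, OpenCone.vertex C.L = OpenCone.mk v (OpenCone.clamp (0 / 2)) :=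
    fun v => (OpenCone.mk_of_eq_zero _ (by rw [zero_div, OpenCone.clamp_zero])).symm
  obtain ⟨ρ', hρ'⟩ := exists_isIntervalChart_quotient (G := Torus m) (I := Ico 0 1)
    hs.continuousOn (hρ.isOpen_inter_preimage C.chart.open_source isOpen_Iio)
    (hρ.mono inter_subset_left) hsi (fun y hy t _ => by
      simp only [ρ]
      rw [C.chart_smul t y hy.1, OpenCone.height_map]) (fun y hy => by
      refine ⟨⟨mul_nonneg zero_le_two (OpenCone.height_nonneg _), hy.2⟩, ?_⟩
      rcases OpenCone.eq_vertex_or_mk (C.chart y).2 with hc | ⟨v, r, hr, hc⟩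
      · refine horb y hy.1 _ v₀ ?_
        simp only [ρ]
        rw [hc, OpenCone.height_vertex, mul_zero]
        exact hvert v₀
      · refine horb y hy.1 _ v ?_
        have hlt := hy.2
        simp only [ρ, mem_preimage, mem_Iio] at hlt ⊢
        rw [hc, OpenCone.height_mk] at hlt ⊢
        congr 1
        apply Subtype.ext
        rw [OpenCone.coe_clamp] <;> linarith)
  refine ⟨_, ρ', hρ', ?_⟩
  obtain ⟨t, ht⟩ := horb x C.mem_source 0 v₀ (C.chart_snd.trans (hvert v₀))
  exact (Quotient.sound ⟨t, ht⟩ : (Quotient.mk _ x : MulAction.orbitRel.Quotient (Torus m) X) =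
    Quotient.mk _ (s 0)).symm

/-- The orbit of a vertex with more than one sheet is an inner point of a path in the orbit
space. -/
theorem exists_path_of_notMem_sheet {v w : C.L} (h : w ∉ C.sheet v) :
    ∃ f : ℝ → MulAction.orbitRel.Quotient (Torus m) X, Continuous f ∧
      InjOn f (Ioo (-(1 / 2)) (1 / 2)) ∧ f 0 = Quotient.mk _ x := by
  let s : ℝ → X := fun z => C.chart.symm ((C.chart x).1, OpenCone.twoRays v w z)
  have hs : Continuous s := C.continuous_symm.comp
    (continuous_const.prodMk (OpenCone.continuous_twoRays v w))
  have hval : ∀ z ∈ Ioo (-(1 / 2) : ℝ) (1 / 2),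
      OpenCone.signedHeight (C.sheet v) (C.chart (s z)).2 = z := by
    intro z hz
    simp only [s]
    rw [C.apply_symm]
    exact OpenCone.signedHeight_twoRays (A := C.sheet v) (v := v) rfl h (abs_le.2 ⟨hz.1.le, hz.2.le⟩)
  refine ⟨fun z => Quotient.mk _ (s z), continuous_quotient_mk'.comp hs, ?_, ?_⟩
  · intro z hz z' hz' hzz
    obtain ⟨t, ht⟩ : ∃ t : Torus m, t • s z' = s z := Quotient.exact hzz
    rw [← hval z hz, ← hval z' hz', ← ht, C.chart_smul t _ (C.symm_mem _)]
    exact OpenCone.signedHeight_map (fun u => C.smul_mem_sheet v u _) _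
  · simp only [s]
    rw [OpenCone.twoRays_zero, ← C.chart_snd, Prod.mk.eta, C.chart.left_inv C.mem_source]

/-- With two sheets, the vertex would be an inner point of an injective path in `[0,1]`, while as an
element of `V` it is sent to an extremum. -/
theorem mem_sheet_of_isIntervalGraph {V : Set (MulAction.orbitRel.Quotient (Torus m) X)}
    (hV : IsIntervalGraph _ V) (hx : Quotient.mk _ x ∈ V) (v w : C.L) : w ∈ C.sheet v := by
  by_contra h
  obtain ⟨f, hf, hfi, hf0⟩ := C.exists_path_of_notMem_sheet h
  obtain ⟨e, he⟩ := hV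
  have hc : ContinuousOn (fun z => (e (f z) : ℝ)) (Ioo (-(1 / 2)) (1 / 2)) := by fun_prop
  have hi : InjOn (fun z => (e (f z) : ℝ)) (Ioo (-(1 / 2)) (1 / 2)) := fun z hz z' hz' hzz =>
    hfi hz hz' (e.injective (Subtype.ext hzz))
  have h0 : e (f 0) ∈ ({0, 1} : Set unitInterval) := he ▸ ⟨_, hx, by rw [hf0]⟩
  rcases h0 with h0 | h0
  · refine not_le_of_injOn_Ioo hc hi (t := 0) (by norm_num) fun z _ => ?_
    simp only [h0]
    exact (e (f z)).2.1
  · refine not_ge_of_injOn_Ioo hc hi (t := 0) (by norm_num) fun z _ => ?_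
    rw [mem_singleton_iff] at h0
    simp only [h0]
    exact (e (f z)).2.2

end VertexChart

namespace FreeChart

theorem isLocallyEuclideanAt (C : FreeChart m k x) : IsLocallyEuclideanAt (k + 2) x := by
  obtain ⟨τ, hτ⟩ := exists_torus_chart k (C.chart x).2
  refine .of_chart (C.chart.trans ((OpenPartialHomeomorph.refl (Fin 1 → ℂ)).prod τ)) ?_
    (by simp [Module.finrank_pi_fintype, add_comm])
  rw [OpenPartialHomeomorph.trans_source]
  exact ⟨C.mem_source, mem_univ _, hτ⟩

/-- A short radial segment through the base point is a slice; the orbits near it are classified by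
the modulus of the `Ω`-coordinate. -/
theorem exists_isIntervalChart [ContinuousConstSMul (Torus m) X] (C : FreeChart m k x) :
    ∃ σ ρ, IsIntervalChart (Ioo (-1) 1) σ ρ ∧
      σ 0 = (Quotient.mk _ x : MulAction.orbitRel.Quotient (Torus m) X) := by
  set w₀ := (C.chart x).1
  have hmem : ∀ y ∈ C.chart.source, (C.chart y).1 ∈ C.Ω := fun y hy => by
    have := C.chart.map_source hy
    rw [C.target_eq] at this
    exact this.1
  have hw₀ : w₀ 0 ≠ 0 := C.ne_zero _ (hmem x C.mem_source)
  have hR : 0 < ‖w₀ 0‖ := norm_pos_iff.2 hw₀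
  let f : ℝ → (Fin 1 → ℂ) × Torus k := fun i => (fun j => w₀ j * ((1 + i : ℝ) : ℂ), (C.chart x).2)
  have hf : Continuous f := by fun_prop
  have hf0 : f 0 = C.chart x := by simp [f, w₀]
  have hev : f ⁻¹' C.chart.target ∈ 𝓝 (0 : ℝ) := hf.continuousAt.preimage_mem_nhds
    (C.chart.open_target.mem_nhds (hf0 ▸ C.chart.map_source C.mem_source))
  obtain ⟨δ, hδ, hball⟩ := Metric.mem_nhds_iff.1 hev
  -- `c < δ` keeps the segment in the chart, and `c < 1` keeps the factor `1 + c i` positive.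
  obtain ⟨c, hc, hcδ⟩ := exists_between (lt_min hδ one_pos)
  have hft : ∀ i ∈ Ioo (-1 : ℝ) 1, f (c * i) ∈ C.chart.target := by
    intro i hi
    refine hball ?_
    rw [mem_ball_zero_iff, Real.norm_eq_abs, abs_mul, abs_of_pos hc]
    have := abs_lt.2 hi
    nlinarith [min_le_left δ 1]
  have hpos : ∀ i ∈ Ioo (-1 : ℝ) 1, 0 < 1 + c * i := by
    intro i hi
    nlinarith [min_le_right δ 1, hi.1]
  let s : ℝ → X := fun i => C.chart.symm (f (c * i))
  let ρ : X → ℝ := fun y => (‖(C.chart y).1 0‖ / ‖w₀ 0‖ - 1) / c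
  have hs : ContinuousOn s (Ioo (-1) 1) := C.chart.continuousOn_symm.comp
    (hf.comp (by fun_prop)).continuousOn hft
  have hρ : ContinuousOn ρ C.chart.source := by
    have h1 : Continuous fun p : (Fin 1 → ℂ) × Torus k => (‖p.1 0‖ / ‖w₀ 0‖ - 1) / c := by
      fun_prop
    exact h1.comp_continuousOn C.chart.continuousOn
  have hsi : ∀ i ∈ Ioo (-1 : ℝ) 1,
      s i ∈ C.chart.source ∩ ρ ⁻¹' Ioo (-1) 1 ∧ ρ (s i) = i := by
    intro i hi
    have : ρ (s i) = i := by
      simp only [ρ, s]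
      rw [C.chart.right_inv (hft i hi)]
      simp only [f]
      rw [norm_mul, Complex.norm_real, Real.norm_eq_abs, abs_of_pos (hpos i hi)]
      field_simp
      ring
    exact ⟨⟨C.chart.map_target (hft i hi), by rw [mem_preimage, this]; exact hi⟩, this⟩
  obtain ⟨ρ', hρ'⟩ := exists_isIntervalChart_quotient (G := Torus m) (I := Ioo (-1) 1) hs
    (hρ.isOpen_inter_preimage C.chart.open_source isOpen_Ioo) (hρ.mono inter_subset_left) hsi
    (fun y hy t _ => by
      simp only [ρ]
      rw [C.chart_smul t y hy.1]
      simp only [norm_mul, Circle.norm_coe, one_mul]) (fun y hy => by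
      refine ⟨hy.2, ?_⟩
      have hsy := (hsi _ hy.2).1.1
      have hy0 : (C.chart y).1 0 ≠ 0 := C.ne_zero _ (hmem y hy.1)
      have hchart : C.chart (s (ρ y)) = f (c * ρ y) := C.chart.right_inv (hft _ hy.2)
      have hn : 1 + c * ρ y = ‖(C.chart y).1 0‖ / ‖w₀ 0‖ := by
        simp only [ρ]
        field_simp
        ring
      have hq : ‖(C.chart y).1 0 / (w₀ 0 * ((1 + c * ρ y : ℝ) : ℂ))‖ = 1 := by
        rw [hn, norm_div, norm_mul, Complex.norm_real, Real.norm_eq_abs,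
          abs_of_nonneg (by positivity), mul_div_cancel₀ _ hR.ne', div_self (norm_ne_zero_iff.2 hy0)]
      -- The slice point and `y` have `Ω`-coordinates of equal modulus, so their quotient is a
      -- rotation.
      let u : Circle := ⟨_, mem_sphere_zero_iff_norm.2 hq⟩
      refine ⟨C.α.symm (fun _ => u, (C.chart y).2 / (C.chart x).2),
        C.chart.injOn (C.smul_mem _ _ hsy) hy.1 ?_⟩
      rw [C.chart_smul _ _ hsy, MulEquiv.apply_symm_apply, hchart]
      refine Prod.ext (funext fun j => ?_) ?_
      · rw [Subsingleton.elim j 0]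
        have hne : w₀ 0 * ((1 + c * ρ y : ℝ) : ℂ) ≠ 0 :=
          mul_ne_zero hw₀ (by exact_mod_cast (hpos _ hy.2).ne')
        exact div_mul_cancel₀ _ hne
      · simp [f])
  refine ⟨_, ρ', hρ', ?_⟩
  simp only [s]
  rw [mul_zero, hf0, C.chart.left_inv C.mem_source]

end FreeChart

end Local

/-! ### Locally standard pseudomanifolds over graphs -/

section Graph

variable {m : ℕ} {X : Type u} [TopologicalSpace X] [MulAction (Torus m) X]

theorem orbitHasDim_or (h : IsFilteredTorusSpace 0 m 1 X) (x : X) :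
    OrbitHasDim m x (m - 1) ∨ OrbitHasDim m x (1 + (m - 1)) := by
  have hp := h.pseudomanifold
  rw [IsStratifiedPseudomanifold] at hp
  have hx : x ∈ orbitFiltration 0 m 1 X (0 + (m - 1) + 2 * 1) := hp.1.top ▸ mem_univ x
  obtain ⟨-, j, hj, hxj⟩ := hx
  have := h.orbit_dim x j hxj
  have hj' : j = m - 1 ∨ j = 1 + (m - 1) := by omega
  rcases hj' with rfl | rfl
  · exact Or.inl hxj
  · exact Or.inr hxj

theorem mem_orbitSpaceFiltration_zero_iff (h : IsFilteredTorusSpace 0 m 1 X)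
    (q : MulAction.orbitRel.Quotient (Torus m) X) :
    q ∈ orbitSpaceFiltration 0 m 1 X 0 ↔
      ∃ x : X, OrbitHasDim m x (m - 1) ∧ Quotient.mk _ x = q := by
  constructor
  · rintro ⟨-, x, ⟨-, j, hj, hxj⟩, hq⟩
    have := h.orbit_dim x j hxj
    obtain rfl : j = m - 1 := by omega
    exact ⟨x, hxj, hq⟩
  · rintro ⟨x, hx, hq⟩
    exact ⟨le_rfl, x, ⟨by omega, m - 1, by omega, hx⟩, hq⟩

theorem orbitSpaceFiltration_zero_nonempty (h : IsFilteredTorusSpace 0 m 1 X) :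
    (orbitSpaceFiltration 0 m 1 X 0).Nonempty := by
  have hp := h.pseudomanifold
  rw [IsStratifiedPseudomanifold] at hp
  obtain ⟨x, hx⟩ := hp.1.bot_nonempty
  obtain ⟨-, j, hj, hxj⟩ := hx
  have := h.orbit_dim x j hxj
  obtain rfl : j = m - 1 := by omega
  exact ⟨_, (mem_orbitSpaceFiltration_zero_iff h _).2 ⟨x, hxj, rfl⟩⟩

theorem orbitHasDim_of_stabilizer_eq_bot (h : IsFilteredTorusSpace 0 m 1 X) {x : X}
    (hx : MulAction.stabilizer (Torus m) x = ⊥) : OrbitHasDim m x (1 + (m - 1)) := by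
  have hm := h.le
  -- Here `1 + (m - 1) = m` because `m ≥ 1`, so the stabilizer has to be identified with `T^0`.
  refine ⟨0, by omega, ⟨?_⟩⟩
  have : Subsingleton (MulAction.stabilizer (Torus m) x) := by
    rw [hx]
    infer_instance
  exact {
    toFun := 1
    invFun := 1
    left_inv := fun _ => Subsingleton.elim _ _
    right_inv := fun _ => Subsingleton.elim _ _
    map_mul' := fun _ _ => Subsingleton.elim _ _
    continuous_toFun := continuous_const
    continuous_invFun := continuous_const }

theorem VertexChart.mem_sheet_of_isTopManifold {x x₀ : X} {d : ℕ} (hm : m = 1 ∨ m = 2)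
    (hd : IsTopManifold d X) (C₀ : FreeChart m (m - 1) x₀) (C : VertexChart m (m - 1) x)
    (v w : C.L) : w ∈ C.sheet v := by
  have hle : m - 1 + 2 ≤ d :=
    (hd.isLocallyEuclideanAt x₀).le_of_le_three C₀.isLocallyEuclideanAt (by omega)
  rcases hm with rfl | rfl
  · have : Subsingleton (Torus (1 - 1)) := inferInstanceAs (Subsingleton (Torus 0))
    exact C.mem_sheet_of_puncturedConnected
      ((hd.isLocallyEuclideanAt x).puncturedConnected hle) v w
  · exact VertexChart.mem_sheet_of_puncturedLog C
      ((hd.isLocallyEuclideanAt x).puncturedLog hle) v w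

end Graph

theorem mainTheorem9 (m : ℕ) (X : Type u) [TopologicalSpace X] [MulAction (Torus m) X]
    (hX : IsLocallyStandardOverGraph m X) :
    (∃ d : ℕ, IsTopManifold d X) ↔
      IsIntervalGraph (MulAction.orbitRel.Quotient (Torus m) X)
        (orbitSpaceFiltration 0 m 1 X 0) := by
  obtain ⟨hconn, hdim, hstd⟩ := hX
  have hF := hstd.isFilteredTorusSpace
  have := hF.t2
  have := hF.compact
  have := hF.secondCountable
  have := hF.continuous
  have hm1 := hF.le
  -- The free orbit serves twice: it bounds the dimension of a manifold structure from below, and it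
  -- makes the links nonempty.
  obtain ⟨x₀, hx₀⟩ := hF.free (by norm_num)
  obtain ⟨C₀⟩ := hstd.nonempty_freeChart (orbitHasDim_of_stabilizer_eq_bot hF hx₀)
  constructor
  · rintro ⟨d, hd⟩
    refine isIntervalGraph_of_charts (orbitSpaceFiltration_zero_nonempty hF) ?_ ?_
    · intro q hq
      obtain ⟨x, hx, rfl⟩ := (mem_orbitSpaceFiltration_zero_iff hF q).1 hq
      obtain ⟨C⟩ := hstd.nonempty_vertexChart hx
      have := C.nonempty_link hx₀
      exact C.exists_isIntervalChart (C.mem_sheet_of_isTopManifold (by omega) hd C₀)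
    · intro q hq
      obtain ⟨x, rfl⟩ := Quotient.exists_rep q
      have hx := (orbitHasDim_or hF x).resolve_left fun hx =>
        hq ((mem_orbitSpaceFiltration_zero_iff hF _).2 ⟨x, hx, rfl⟩)
      obtain ⟨C⟩ := hstd.nonempty_freeChart hx
      exact C.exists_isIntervalChart
  · intro hQ
    refine ⟨m - 1 + 2, isTopManifold_of_isLocallyEuclideanAt fun x => ?_⟩
    rcases orbitHasDim_or hF x with hx | hx
    · obtain ⟨C⟩ := hstd.nonempty_vertexChart hx
      have := C.nonempty_link hx₀
      exact C.isLocallyEuclideanAt (C.mem_sheet_of_isIntervalGraph hQ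
        ((mem_orbitSpaceFiltration_zero_iff hF _).2 ⟨x, hx, rfl⟩))
    · obtain ⟨C⟩ := hstd.nonempty_freeChart hx
      exact C.isLocallyEuclideanAt
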